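/- Let $n\ge 1$, let $\Omega\subset\mathbb{R}^n$ be a bounded domain, $\varepsilon>0$, and put $\Gamma_\varepsilon=\{x\in\mathbb{R}^n\setminus\Omega:\operatorname{dist}(x,\partial\Omega)\le\varepsilon\}$. Let $0<\alpha<1$, $\beta=1-\alpha$, $\gamma\ge 0$ with $\gamma\varepsilon^2<\tfrac12$, and $F:\Gamma_\varepsilon\to\mathbb{R}$. Consider the following two-player zero-sum game. A token starts at $x_0$. In every round, with probability $\alpha/2$ Player I moves it, with probability $\alpha/2$ Player II moves it, and with probability $\beta$ it moves at random: $X_0=x_0$ and $X_k=X_{k-1}+\varepsilon s$, where $s\in B_1(0)$ is the vector that the strategy of the player whose turn it is prescribes, respectively is chosen uniformly in $B_1(0)$. The random choices of different rounds are independent. A strategy is a sequence of Borel functions, with values in the open unit ball $B_1(0)$, of the history (the past positions and coin results). The game ends at $\tau=\min\{k\ge 0:X_k\in\Gamma_\varepsilon\}$, and Player II then pays $(1-\gamma\varepsilon^2)^\tau F(X_\tau)$ to Player I. The values of the game for the two players are $$u_\varepsilon^{\mathrm I}(x_0)=\sup_{S_{\mathrm I}}\inf_{S_{\mathrm{II}}}\mathbb{E}^{x_0}_{S_{\mathrm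 I},S_{\mathrm{II}}}\big[(1-\gamma\varepsilon^2)^\tau F(X_\tau)\big],\qquad u_\varepsilon^{\mathrm{II}}(x_0)=\inf_{S_{\mathrm{II}}}\sup_{S_{\mathrm I}}\mathbb{E}^{x_0}_{S_{\mathrm I},S_{\mathrm{II}}}\big[(1-\gamma\varepsilon^2)^\tau F(X_\tau)\big];$$ their common value, where they coincide, is the value function $u_\varepsilon$ with boundary data $F$. Assume that $\Omega$ satisfies the exterior sphere condition: for every $y\in\partial\Omega$ there is a ball $B_\delta(w)\subset\mathbb{R}^n\setminus\Omega$ with $\delta>0$ and $y\in\partial B_\delta(w)$. Assume also that $F$ is Lipschitz on $\Gamma_\varepsilon$, and let $$\|F\|_{C^{0,1}(\Gamma_\varepsilon)}=\sup_{\Gamma_\varepsilon}|F|+\sup_{p\ne q\in\Gamma_\varepsilon}\frac{|F(p)-F(q)|}{|p-q|}.$$ Let $y\in\partial\Omega$, let $B_\delta(w)\subset\mathbb{R}^n\setminus\Omega$ be a ball with $\delta>0$ and $y\in\partial B_\delta(w)$, and let $R$ be such that $\Omega\subset B_R(w)$. Then $u_\varepsilon=u_\varepsilon^{\mathrm I}$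 and $u_\varepsilon=u_\varepsilon^{\mathrm{II}}$ both satisfy $u_\varepsilon(z)=F(z)$ and $$|u_\varepsilon(x)-u_\varepsilon(z)|=|u_\varepsilon(x)-F(z)|\le C\,\|F\|_{C^{0,1}(\Gamma_\varepsilon)}\big(|x-y|+\rho(\varepsilon)\big)+\|F\|_{C^{0,1}(\Gamma_\varepsilon)}\,\delta$$ for every $x\in\Omega$ and every $z\in\Gamma_\varepsilon$ with $|z-y|\le\delta$. Here $C>0$ depends only on $n$, $R/\delta$ and $\gamma$, and $\rho(\varepsilon)\to 0$ as $\varepsilon\to 0^+$, where the function $\rho$ depends only on $n,\alpha,\gamma,R,\delta$ (not on $\Omega$, $F$, $y$, $w$, $x$, $z$). -/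

import Mathlib

open MeasureTheory Set Filter Topology

noncomputable section

namespace TugOfWar

/-- Euclidean space `ℝⁿ`. -/
abbrev Pt (n : ℕ) := EuclideanSpace ℝ (Fin n)

/-- The outer boundary strip `Γ_ε = {x ∈ ℝⁿ ∖ Ω : dist(x, ∂Ω) ≤ ε}`. -/
def outerStrip {n : ℕ} (Ω : Set (Pt n)) (ε : ℝ) : Set (Pt n) :=
  {x | x ∉ Ω ∧ Metric.infDist x (frontier Ω) ≤ ε}

/-- The ball `B_δ(w)` lies outside `Ω` and its boundary sphere passes through `y`. -/
def IsExteriorBall {n : ℕ} (Ω : Set (Pt n)) (y w : Pt n) (δ : ℝ) : Prop :=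
  0 < δ ∧ Metric.ball w δ ⊆ Ωᶜ ∧ y ∈ Metric.sphere w δ

/-- The exterior sphere condition: every boundary point is touched by an exterior ball. -/
def ExteriorSphereCondition {n : ℕ} (Ω : Set (Pt n)) : Prop :=
  ∀ y ∈ frontier Ω, ∃ (w : Pt n) (δ : ℝ), IsExteriorBall Ω y w δ

/-- The norm `‖F‖_{C^{0,1}(s)} = sup_s |F| + sup_{x ≠ z in s} |F(x) - F(z)| / |x - z|`
(pairs with `x = z` contribute `0 / 0 = 0`). -/
def lipNorm {n : ℕ} (s : Set (Pt n)) (F : Pt n → ℝ) : ℝ :=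
  (⨆ x : s, |F x|) + ⨆ p : s × s, |F p.1 - F p.2| / dist (p.1 : Pt n) (p.2 : Pt n)

/-- The outcome of a round: Player I moves, Player II moves, or the token moves at random. -/
inductive Turn : Type
  | playerI : Turn
  | playerII : Turn
  | random : Turn

instance : MeasurableSpace Turn := ⊤

/-- The part `((c₁, x₁), …, (c_k, x_k))` of the history after `k` rounds. -/
abbrev Hist (n k : ℕ) := Fin k → Turn × Pt n

/-- A strategy: for every `k`, a Borel function from histories `(x₀, (c₁, x₁), …, (c_k, x_k))`
to the open unit ball `B₁`. -/
structure Strategy (n : ℕ) where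
  move : (k : ℕ) → Pt n × Hist n k → Pt n
  measurable_move : ∀ k, Measurable (move k)
  move_mem : ∀ k h, move k h ∈ Metric.ball (0 : Pt n) 1

/-- The current position `x_k` in a history starting at `x₀`. -/
def lastPos {n : ℕ} (x₀ : Pt n) : (k : ℕ) → Hist n k → Pt n
  | 0, _ => x₀
  | k + 1, h => (h (Fin.last k)).2

/-- The result of a round with random number `ξ ∈ [0,1]`: each player moves with probability
`α / 2`, and a random move takes place with probability `1 - α`. -/
def turnOf (α ξ : ℝ) : Turn :=
  if ξ < α / 2 then Turn.playerI else if ξ < α then Turn.playerII else Turn.random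

/-- The position reached from the history `h` when the result of the round is `c` and the random
direction is `w`. -/
def nextPos {n : ℕ} (ε : ℝ) (SI SII : Strategy n) (x₀ : Pt n) (k : ℕ) (h : Hist n k)
    (c : Turn) (w : Pt n) : Pt n :=
  match c with
  | Turn.playerI => lastPos x₀ k h + ε • SI.move k (x₀, h)
  | Turn.playerII => lastPos x₀ k h + ε • SII.move k (x₀, h)
  | Turn.random => lastPos x₀ k h + ε • w

/-- The history of the game after `k` rounds. The sample `ω k = (ξ_k, w_k)` supplies the
randomness of the round `k + 1`. -/
def history {n : ℕ} (α ε : ℝ) (SI SII : Strategy n) (x₀ : Pt n) (ω : ℕ → ℝ × Pt n) :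
    (k : ℕ) → Hist n k
  | 0 => fun i => i.elim0
  | k + 1 =>
      let h := history α ε SI SII x₀ ω k
      let c := turnOf α (ω k).1
      Fin.snoc (α := fun _ => Turn × Pt n) h (c, nextPos ε SI SII x₀ k h c (ω k).2)

/-- The position `X_k` of the token after `k` rounds. -/
def position {n : ℕ} (α ε : ℝ) (SI SII : Strategy n) (x₀ : Pt n) (ω : ℕ → ℝ × Pt n) (k : ℕ) :
    Pt n :=
  lastPos x₀ k (history α ε SI SII x₀ ω k)

/-- The law of `(ξ, w)`: uniform on `[0,1]` times uniform on the unit ball `B₁`. -/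
def stepLaw (n : ℕ) : Measure (ℝ × Pt n) :=
  (ProbabilityTheory.cond volume (Icc (0 : ℝ) 1)).prod
    (ProbabilityTheory.cond volume (Metric.ball (0 : Pt n) 1))

instance (n : ℕ) : IsProbabilityMeasure (stepLaw n) := by
  have h1 : IsProbabilityMeasure
      (ProbabilityTheory.cond (volume : Measure ℝ) (Icc (0 : ℝ) 1)) :=
    ProbabilityTheory.cond_isProbabilityMeasure_of_finite (by simp) (by simp)
  have h2 : IsProbabilityMeasure
      (ProbabilityTheory.cond (volume : Measure (Pt n)) (Metric.ball (0 : Pt n) 1)) :=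
    ProbabilityTheory.cond_isProbabilityMeasure_of_finite
      (Metric.measure_ball_pos _ _ one_pos).ne' measure_ball_lt_top.ne
  unfold stepLaw
  infer_instance

/-- The law of the independent sequence `(ξ_k, w_k)_{k ≥ 0}`. -/
def gameLaw (n : ℕ) : Measure (ℕ → ℝ × Pt n) :=
  Measure.infinitePi fun _ => stepLaw n

open scoped Classical in
/-- The discounted payoff `(1 - γ ε²)^τ F(X_τ)`, where `τ = min {k ≥ 0 : X_k ∈ Γ_ε}`.
It is set to `0` if the game never ends. -/
def payoff {n : ℕ} (Ω : Set (Pt n)) (F : Pt n → ℝ) (α γ ε : ℝ) (SI SII : Strategy n) (x₀ : Pt n)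
    (ω : ℕ → ℝ × Pt n) : ℝ :=
  if h : ∃ k, position α ε SI SII x₀ ω k ∈ outerStrip Ω ε then
    (1 - γ * ε ^ 2) ^ Nat.find h * F (position α ε SI SII x₀ ω (Nat.find h))
  else 0

/-- The expected discounted payoff `𝔼^{x₀}_{S_I, S_II}[(1 - γ ε²)^τ F(X_τ)]`. -/
def expectedPayoff {n : ℕ} (Ω : Set (Pt n)) (F : Pt n → ℝ) (α γ ε : ℝ) (SI SII : Strategy n)
    (x₀ : Pt n) : ℝ :=
  ∫ ω, payoff Ω F α γ ε SI SII x₀ ω ∂gameLaw n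

/-- The value for Player I: `sup_{S_I} inf_{S_II} 𝔼[(1 - γ ε²)^τ F(X_τ)]`. -/
def valueI {n : ℕ} (Ω : Set (Pt n)) (F : Pt n → ℝ) (α γ ε : ℝ) (x₀ : Pt n) : ℝ :=
  ⨆ SI : Strategy n, ⨅ SII : Strategy n, expectedPayoff Ω F α γ ε SI SII x₀

/-- The value for Player II: `inf_{S_II} sup_{S_I} 𝔼[(1 - γ ε²)^τ F(X_τ)]`. -/
def valueII {n : ℕ} (Ω : Set (Pt n)) (F : Pt n → ℝ) (α γ ε : ℝ) (x₀ : Pt n) : ℝ :=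
  ⨅ SII : Strategy n, ⨆ SI : Strategy n, expectedPayoff Ω F α γ ε SI SII x₀

end TugOfWar

end

/-! A barrier argument at the exterior ball. Put V(p) = λ(|p−z|²+δ²)/(2δ) + A(e^{−μδ²} −
e^{−μ|p−w|²}). If ε is small and one player always moves down the gradient of V, then at every point
of Ω the mean of V drops by at least ε²/δ per round, whatever the opponent does. To first order the
pull cancels the opponent's best move, and the strong radial concavity of the exponential part gives
a negative second-order term (`barrier_pull_add_le`); random moves have no first-order mean and feel
the same concavity (`barrier_integral_le`). Hence V(X_{k∧τ}) + (k∧τ)ε²/δ is a supermartingale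
(`integral_stoppedProcess_le`).

Its first summand controls |F(X_τ) − F(z)|, because the quadratic part of V dominates λ|p−z|; its
second summand pays for discounting. With M = sup|F|, L the Lipschitz constant and N = (1+γ)(M+L),
Nλ = L, this bounds the mean of |payoff − F(z)| by N V(x) + Mδ + O(ε) (`abs_payoff_sub_le`,
`abs_expectedPayoff_sub_le`). As V(x) ≤ λδ + O(|x−y|), the terms Lδ and Mδ add up to exactly the
norm of F times δ.

The bound is two-sided, so the same pulling strategy serves either player, and `abs_value_sub_le`
transfers it to both values without dynamic programming or equality of the values. Nor is almost
sure termination needed: everything is evaluated at a fixed round k so late that a game still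
running then has a stopped process at least 2. -/

noncomputable section

namespace TugOfWar

variable {n : ℕ}

/-! ### Moments of the uniform distribution on the ball -/

/-- The uniform distribution on the open unit ball. -/
abbrev uniformBall (n : ℕ) : Measure (Pt n) :=
  ProbabilityTheory.cond volume (Metric.ball (0 : Pt n) 1)

instance : IsProbabilityMeasure (uniformBall n) :=
  ProbabilityTheory.cond_isProbabilityMeasure_of_finite
    (Metric.measure_ball_pos _ _ one_pos).ne' measure_ball_lt_top.ne

lemma ae_uniformBall_mem : ∀ᵐ s ∂uniformBall n, s ∈ Metric.ball (0 : Pt n) 1 :=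
  ProbabilityTheory.ae_cond_mem measurableSet_ball

lemma integrable_uniformBall_of_continuous {f : Pt n → ℝ} (hf : Continuous f) :
    Integrable f (uniformBall n) := by
  obtain ⟨C, hC⟩ := (isCompact_closedBall (0 : Pt n) 1).exists_bound_of_continuousOn hf.continuousOn
  refine Integrable.of_bound hf.aestronglyMeasurable C ?_
  filter_upwards [ae_uniformBall_mem] with s hs
  exact hC s (Metric.ball_subset_closedBall hs)

lemma integral_inner_uniformBall (g : Pt n) : ∫ s, inner ℝ g s ∂uniformBall n = 0 := by
  have h : ∫ s in Metric.ball (0 : Pt n) 1, inner ℝ g s = 0 := by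
    rw [← integral_indicator measurableSet_ball]
    have h1 := integral_neg_eq_self
      ((Metric.ball (0 : Pt n) 1).indicator fun s => inner ℝ g s) volume
    have h2 : ∀ s, (Metric.ball (0 : Pt n) 1).indicator (fun s => inner ℝ g s) (-s) =
        -(Metric.ball (0 : Pt n) 1).indicator (fun s => inner ℝ g s) s := by
      intro s
      by_cases hs : s ∈ Metric.ball (0 : Pt n) 1
      · rw [indicator_of_mem hs, indicator_of_mem (by simpa using hs), inner_neg_right]
      · rw [indicator_of_notMem hs, indicator_of_notMem (by simpa using hs), neg_zero]
    simp only [h2, integral_neg] at h1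
    linarith
  unfold uniformBall ProbabilityTheory.cond
  rw [integral_smul_measure, h, smul_zero]

/-- By symmetry of the ball the linear term of a Taylor bound has mean zero, so only the concave
quadratic term survives. -/
lemma integral_uniformBall_le_of_le_quadratic {f : Pt n → ℝ} (hf : Continuous f) {K a b : ℝ}
    {g v : Pt n} (h : ∀ s, ‖s‖ ≤ 1 → f s ≤ K + a * inner ℝ g s - b * inner ℝ v s ^ 2) :
    ∫ s, f s ∂uniformBall n ≤ K - b * ∫ s, inner ℝ v s ^ 2 ∂uniformBall n := by
  have h1 : Integrable (fun s : Pt n => K + a * inner ℝ g s) (uniformBall n) :=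
    integrable_uniformBall_of_continuous (by fun_prop)
  have h2 : Integrable (fun s : Pt n => a * inner ℝ g s) (uniformBall n) :=
    integrable_uniformBall_of_continuous (by fun_prop)
  have h3 : Integrable (fun s : Pt n => b * inner ℝ v s ^ 2) (uniformBall n) :=
    integrable_uniformBall_of_continuous (by fun_prop)
  have hle : ∫ s, f s ∂uniformBall n ≤
      ∫ s, (K + a * inner ℝ g s - b * inner ℝ v s ^ 2) ∂uniformBall n := by
    refine integral_mono_ae (integrable_uniformBall_of_continuous hf) (h1.sub h3) ?_
    filter_upwards [ae_uniformBall_mem] with s hs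
    exact h s (mem_ball_zero_iff.1 hs).le
  rwa [integral_sub h1 h3, integral_add (integrable_const K) h2, integral_const_mul,
    integral_const_mul, integral_inner_uniformBall, integral_const, probReal_univ, one_smul,
    mul_zero, add_zero] at hle

/-- The covariance of the uniform distribution on the ball is bounded from below. -/
lemma exists_le_integral_inner_sq_uniformBall (n : ℕ) :
    ∃ c : ℝ, 0 < c ∧ ∀ v : Pt n, c * ‖v‖ ^ 2 ≤ ∫ s, inner ℝ v s ^ 2 ∂uniformBall n := by
  set c₀ : ℝ := (uniformBall n).real (Metric.ball 0 (1 / 4)) with hc₀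
  have hball : ∀ a : Pt n, ‖a‖ ≤ 1 / 2 →
      uniformBall n (Metric.ball a (1 / 4)) =
        (volume (Metric.ball (0 : Pt n) 1))⁻¹ * volume (Metric.ball (0 : Pt n) (1 / 4)) := by
    intro a ha
    rw [ProbabilityTheory.cond_apply measurableSet_ball, inter_eq_right.2,
      Measure.addHaar_ball_center volume a]
    intro s hs
    rw [mem_ball_zero_iff]
    rw [mem_ball_iff_norm] at hs
    linarith [norm_add_le (s - a) a, congrArg norm (sub_add_cancel s a)]
  have hpos : 0 < c₀ := by
    rw [hc₀, Measure.real, hball 0 (by simp)]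
    refine ENNReal.toReal_pos (mul_ne_zero ?_ ?_) (ENNReal.mul_ne_top ?_ measure_ball_lt_top.ne)
    · simpa using measure_ball_lt_top.ne
    · exact (Metric.measure_ball_pos _ _ (by norm_num)).ne'
    · simpa using (Metric.measure_ball_pos volume (0 : Pt n) one_pos).ne'
  refine ⟨c₀ / 16, by positivity, fun v => ?_⟩
  rcases eq_or_ne v 0 with rfl | hv
  · simp
  have hv' : 0 < ‖v‖ := norm_pos_iff.2 hv
  -- The ball of radius 1/4 about v/(2‖v‖) lies in the unit ball, has mass `c₀` in every direction
  -- by translation invariance, and ⟨v, s⟩ ≥ ‖v‖/4 on it; hence the constant `c₀ / 16`.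
  set a : Pt n := (1 / (2 * ‖v‖)) • v with ha
  have hna : ‖a‖ = 1 / 2 := by
    rw [ha, norm_smul, Real.norm_of_nonneg (by positivity)]; field_simp
  have hva : inner ℝ v a = ‖v‖ / 2 := by
    rw [ha, inner_smul_right, real_inner_self_eq_norm_sq]; field_simp
  have hreal : (uniformBall n).real (Metric.ball a (1 / 4)) = c₀ := by
    rw [hc₀, Measure.real, Measure.real, hball a hna.le, hball 0 (by simp)]
  have hint : Integrable (fun s : Pt n => inner ℝ v s ^ 2) (uniformBall n) :=
    integrable_uniformBall_of_continuous (by fun_prop)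
  calc c₀ / 16 * ‖v‖ ^ 2
      = ∫ s in Metric.ball a (1 / 4), (‖v‖ / 4) ^ 2 ∂uniformBall n := by
        rw [setIntegral_const, hreal, smul_eq_mul]; ring
    _ ≤ ∫ s in Metric.ball a (1 / 4), inner ℝ v s ^ 2 ∂uniformBall n := by
        refine setIntegral_mono_on (by simp) hint.integrableOn measurableSet_ball ?_
        intro s hs
        rw [mem_ball_iff_norm] at hs
        have h1 : inner ℝ v s = ‖v‖ / 2 + inner ℝ v (s - a) := by rw [inner_sub_right, hva]; ring
        have h2 := neg_le_of_abs_le (abs_real_inner_le_norm v (s - a))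
        have h3 : ‖v‖ * ‖s - a‖ ≤ ‖v‖ * (1 / 4) := by gcongr
        have h4 : ‖v‖ / 4 ≤ inner ℝ v s := by linarith
        gcongr
    _ ≤ _ := setIntegral_le_integral hint (ae_of_all _ fun s => sq_nonneg _)

/-! ### The barrier and its decrease in one round -/

/-- The barrier at the exterior ball `B_δ(w)`, added to a quadratic majorant of
`lam * dist · z`. -/
def barrier (w z : Pt n) (δ μ A lam : ℝ) (p : Pt n) : ℝ :=
  lam * ((‖p - z‖ ^ 2 + δ ^ 2) / (2 * δ)) +
    A * (Real.exp (-(μ * δ ^ 2)) - Real.exp (-(μ * ‖p - w‖ ^ 2)))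

/-- The radial slope of the exponential part of the barrier, divided by the radius. -/
def slope (w : Pt n) (μ A : ℝ) (p : Pt n) : ℝ :=
  2 * μ * A * Real.exp (-(μ * ‖p - w‖ ^ 2))

/-- The gradient of the barrier. -/
def barrierGrad (w z : Pt n) (δ μ A lam : ℝ) (p : Pt n) : Pt n :=
  (lam / δ) • (p - z) + slope w μ A p • (p - w)

/-- The direction, of length less than one, in which a player decreases the barrier. -/
def pullDir (w z : Pt n) (δ μ A lam ε : ℝ) (p : Pt n) : Pt n :=
  -((‖barrierGrad w z δ μ A lam p‖ + ε / δ)⁻¹ • barrierGrad w z δ μ A lam p)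

lemma continuous_barrier (w z : Pt n) (δ μ A lam : ℝ) :
    Continuous (barrier w z δ μ A lam) := by
  unfold barrier
  fun_prop

lemma continuous_barrierGrad (w z : Pt n) (δ μ A lam : ℝ) :
    Continuous (barrierGrad w z δ μ A lam) := by
  unfold barrierGrad slope
  fun_prop

lemma measurable_pullDir (w z : Pt n) (δ μ A lam ε : ℝ) :
    Measurable (pullDir w z δ μ A lam ε) := by
  have h := (continuous_barrierGrad w z δ μ A lam).measurable
  unfold pullDir
  fun_prop

lemma norm_pullDir_lt_one (w z : Pt n) {δ ε : ℝ} (μ A lam : ℝ) (hδ : 0 < δ) (hε : 0 < ε)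
    (p : Pt n) : ‖pullDir w z δ μ A lam ε p‖ < 1 := by
  have h : 0 < ε / δ := by positivity
  have h' := norm_nonneg (barrierGrad w z δ μ A lam p)
  rw [pullDir, norm_neg, norm_smul, norm_inv, Real.norm_of_nonneg (by positivity),
    inv_mul_lt_one₀ (by positivity)]
  linarith

/-- Second-order upper bound for the barrier. -/
lemma barrier_add_smul_le (w z : Pt n) {δ μ A lam ε R : ℝ} (hδ : 0 < δ) (hμ : 0 < μ) (hA : 0 ≤ A)
    (hε : 0 < ε) (hεR : ε ≤ R) (hsmall : 3 * μ * ε * R ≤ 1) {p s : Pt n} (hp : ‖p - w‖ ≤ R)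
    (hs : ‖s‖ ≤ 1) :
    barrier w z δ μ A lam (p + ε • s) ≤ barrier w z δ μ A lam p
      + ε * inner ℝ (barrierGrad w z δ μ A lam p) s
      + ε ^ 2 / 2 * ((lam / δ + slope w μ A p) * ‖s‖ ^ 2
          - 2 * μ * slope w μ A p * inner ℝ (p - w) s ^ 2)
      + (2 * μ * A) * (μ * R + 14 * μ ^ 2 * R ^ 3) * ε ^ 3 := by
  set σ : ℝ := inner ℝ (p - w) s with hσ
  set t : ℝ := 2 * ε * σ + ε ^ 2 * ‖s‖ ^ 2 with ht
  set E : ℝ := Real.exp (-(μ * ‖p - w‖ ^ 2)) with hE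
  have hR : 0 < R := hε.trans_le hεR
  have hnw : ‖p + ε • s - w‖ ^ 2 = ‖p - w‖ ^ 2 + t := by
    rw [show p + ε • s - w = (p - w) + ε • s by abel, norm_add_sq_real, inner_smul_right, norm_smul,
      Real.norm_of_nonneg hε.le, ht]
    ring
  have hnz : ‖p + ε • s - z‖ ^ 2 = ‖p - z‖ ^ 2 + (2 * ε * inner ℝ (p - z) s + ε ^ 2 * ‖s‖ ^ 2) := by
    rw [show p + ε • s - z = (p - z) + ε • s by abel, norm_add_sq_real, inner_smul_right, norm_smul,
      Real.norm_of_nonneg hε.le]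
    ring
  have hσR : |σ| ≤ R := (abs_real_inner_le_norm _ _).trans <|
    (mul_le_mul hp hs (norm_nonneg _) hR.le).trans_eq (mul_one R)
  have hs2 : ‖s‖ ^ 2 ≤ 1 := pow_le_one₀ (norm_nonneg _) hs
  have htR : |t| ≤ 3 * ε * R := by
    have h1 : |t| ≤ |2 * ε * σ| + |ε ^ 2 * ‖s‖ ^ 2| := abs_add_le _ _
    rw [abs_mul (2 * ε), abs_of_pos (by positivity : 0 < 2 * ε),
      abs_of_nonneg (by positivity : 0 ≤ ε ^ 2 * ‖s‖ ^ 2)] at h1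
    have h2 : 2 * ε * |σ| ≤ 2 * ε * R := by gcongr
    have h3 : ε ^ 2 * ‖s‖ ^ 2 ≤ ε * R := by
      calc ε ^ 2 * ‖s‖ ^ 2 ≤ ε ^ 2 * 1 := by gcongr
        _ = ε * ε := by ring
        _ ≤ ε * R := by gcongr
    linarith
  have hμt : |-(μ * t)| ≤ 1 := by
    rw [abs_neg, abs_mul, abs_of_pos hμ]
    calc μ * |t| ≤ μ * (3 * ε * R) := by gcongr
      _ ≤ 1 := by linarith
  -- Second-order Taylor expansion; the remainder constant 2/9 of `Real.exp_bound` is relaxed to 1.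
  -- Its requirement |μt| ≤ 1 is the reason for `hsmall`.
  have hexp : 1 - μ * t + (μ * t) ^ 2 / 2 - (μ * |t|) ^ 3 ≤ Real.exp (-(μ * t)) := by
    have h := Real.exp_bound hμt (n := 3) (by norm_num)
    rw [abs_neg, abs_mul, abs_of_pos hμ] at h
    have h0 : 0 ≤ (μ * |t|) ^ 3 := by positivity
    simp [Finset.sum_range_succ, Nat.factorial] at h
    have := (abs_le.1 h).1
    nlinarith
  have hcube : (μ * |t|) ^ 3 ≤ μ ^ 3 * (27 * ε ^ 3 * R ^ 3) := by
    calc (μ * |t|) ^ 3 ≤ (μ * (3 * ε * R)) ^ 3 := by gcongr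
      _ = _ := by ring
  have hsq : 4 * ε ^ 2 * σ ^ 2 - 4 * ε ^ 3 * R ≤ t ^ 2 := by
    have h1 : -(R * 1) ≤ σ * ‖s‖ ^ 2 := by
      refine neg_le_of_abs_le ?_
      rw [abs_mul, abs_of_nonneg (by positivity : 0 ≤ ‖s‖ ^ 2)]
      gcongr
    have h2 : 4 * ε ^ 3 * (-(R * 1)) ≤ 4 * ε ^ 3 * (σ * ‖s‖ ^ 2) := by gcongr
    have h3 : t ^ 2 = 4 * ε ^ 2 * σ ^ 2 + 4 * ε ^ 3 * (σ * ‖s‖ ^ 2) + (ε ^ 2 * ‖s‖ ^ 2) ^ 2 := by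
      rw [ht]; ring
    nlinarith [sq_nonneg (ε ^ 2 * ‖s‖ ^ 2)]
  have hE0 : 0 ≤ E := (Real.exp_pos _).le
  have hE1 : E ≤ 1 := by
    rw [hE, Real.exp_le_one_iff]
    have : 0 ≤ μ * ‖p - w‖ ^ 2 := by positivity
    linarith
  have hinner : inner ℝ (barrierGrad w z δ μ A lam p) s =
      lam / δ * inner ℝ (p - z) s + 2 * μ * A * E * σ := by
    rw [barrierGrad, inner_add_left, real_inner_smul_left, real_inner_smul_left, slope]
  have hexp2 : Real.exp (-(μ * ‖p + ε • s - w‖ ^ 2)) = E * Real.exp (-(μ * t)) := by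
    rw [hnw, hE, ← Real.exp_add]; congr 1; ring
  -- The cubic errors are 2μ²R from `hsq` and 27μ³R³ from `hcube`; 27 is rounded up to 28 = 2·14.
  have hlow : 1 - μ * t + μ ^ 2 * (2 * ε ^ 2 * σ ^ 2) - (2 * μ ^ 2 * R + 28 * μ ^ 3 * R ^ 3) * ε ^ 3
      ≤ Real.exp (-(μ * t)) := by
    have h1 : μ ^ 2 * (4 * ε ^ 2 * σ ^ 2 - 4 * ε ^ 3 * R) ≤ μ ^ 2 * t ^ 2 := by gcongr
    have h2 : 0 ≤ μ ^ 3 * (ε ^ 3 * R ^ 3) := by positivity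
    nlinarith
  have hAE : A * E * (1 - μ * t + μ ^ 2 * (2 * ε ^ 2 * σ ^ 2))
      - A * ((2 * μ ^ 2 * R + 28 * μ ^ 3 * R ^ 3) * ε ^ 3) ≤ A * (E * Real.exp (-(μ * t))) := by
    have h1 := mul_le_mul_of_nonneg_left hlow (mul_nonneg hA hE0)
    have h2 : A * E * ((2 * μ ^ 2 * R + 28 * μ ^ 3 * R ^ 3) * ε ^ 3) ≤
        A * 1 * ((2 * μ ^ 2 * R + 28 * μ ^ 3 * R ^ 3) * ε ^ 3) := by gcongr
    linarith
  rw [hinner, barrier, barrier, hexp2, hnz, ← hE, slope, ← hE]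
  have h5 : lam * ((‖p - z‖ ^ 2 + (2 * ε * inner ℝ (p - z) s + ε ^ 2 * ‖s‖ ^ 2) + δ ^ 2) / (2 * δ))
      = lam * ((‖p - z‖ ^ 2 + δ ^ 2) / (2 * δ)) + ε * (lam / δ * inner ℝ (p - z) s)
        + ε ^ 2 / 2 * (lam / δ * ‖s‖ ^ 2) := by
    field_simp
    ring
  rw [h5]
  rw [ht] at hAE
  rw [ht]
  linarith

/-- The sum of the barrier values after a move down the gradient and an arbitrary move. -/
lemma barrier_pull_add_le (w z : Pt n) {δ μ A lam ε R : ℝ} (hδ : 0 < δ) (hμ : 0 < μ)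
    (hA : 0 ≤ A) (hlam : 0 ≤ lam) (hlam1 : lam ≤ 1) (hε : 0 < ε) (hεδ : ε ≤ δ) (hεR : ε ≤ R)
    (hsmall : 3 * μ * ε * R ≤ 1)
    (herr : (2 * μ * A) * (μ * R + 14 * μ ^ 2 * R ^ 3) * ε ≤ 1 / δ)
    (hμ48 : 48 ≤ μ * δ ^ 2) {p s : Pt n} (hpδ : δ ≤ ‖p - w‖) (hp : ‖p - w‖ ≤ R)
    (hslope : 6 / δ ≤ slope w μ A p) (hz : ‖z - w‖ ≤ 2 * δ) (hs : ‖s‖ ≤ 1) :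
    barrier w z δ μ A lam (p + ε • pullDir w z δ μ A lam ε p) + barrier w z δ μ A lam (p + ε • s)
      ≤ 2 * barrier w z δ μ A lam p - 2 * (ε ^ 2 / δ) := by
  have hm1 := (norm_pullDir_lt_one w z μ A lam hδ hε p).le
  have h1 := barrier_add_smul_le w z (lam := lam) hδ hμ hA hε hεR hsmall hp hm1
  have h2 := barrier_add_smul_le w z (lam := lam) hδ hμ hA hε hεR hsmall hp hs
  set B := barrier w z δ μ A lam with hB
  set a' := slope w μ A p with ha'
  set g := barrierGrad w z δ μ A lam p with hg
  set r := ‖p - w‖ with hr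
  set m := pullDir w z δ μ A lam ε p with hm
  set E3 := (2 * μ * A) * (μ * R + 14 * μ ^ 2 * R ^ 3) with hE3
  have hE3ε : E3 * ε ^ 3 ≤ ε ^ 2 / δ := by
    calc E3 * ε ^ 3 = E3 * ε * ε ^ 2 := by ring
      _ ≤ 1 / δ * ε ^ 2 := by gcongr
      _ = ε ^ 2 / δ := by ring
  have hr0 : 0 < r := hδ.trans_le hpδ
  have ha0 : 0 < a' := lt_of_lt_of_le (by positivity) hslope
  have ha6 : 6 ≤ a' * δ := by rwa [div_le_iff₀ hδ] at hslope
  have hlamδ : lam / δ ≤ a' := by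
    rw [div_le_iff₀ hδ]; linarith
  have hlamδ0 : 0 ≤ lam / δ := by positivity
  have hμr : μ * δ ^ 2 ≤ μ * r ^ 2 := by gcongr
  -- The gradient is essentially radial: ‖p−z‖ ≤ 3r and slope ≥ 6/δ make its quadratic part at most
  -- half of its radial part.
  have hdiff : ‖g - a' • (p - w)‖ ≤ a' * r / 2 := by
    have h1 : g - a' • (p - w) = (lam / δ) • (p - z) := by
      rw [hg, barrierGrad]; abel
    rw [h1, norm_smul, Real.norm_of_nonneg hlamδ0]
    have h2 : ‖p - z‖ ≤ 3 * r := by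
      have : ‖p - z‖ ≤ ‖p - w‖ + ‖w - z‖ := norm_sub_le_norm_sub_add_norm_sub _ _ _
      rw [norm_sub_rev w z] at this
      linarith
    calc lam / δ * ‖p - z‖ ≤ 1 / δ * (3 * r) := by gcongr
      _ = (6 / δ) * r / 2 := by ring
      _ ≤ a' * r / 2 := by gcongr
  have hnormg : ‖g‖ ≤ 3 / 2 * (a' * r) := by
    have h1 : ‖g‖ ≤ ‖g - a' • (p - w)‖ + ‖a' • (p - w)‖ := by
      simpa using norm_add_le (g - a' • (p - w)) (a' • (p - w))
    rw [norm_smul, Real.norm_of_nonneg ha0.le] at h1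
    linarith
  have hinner : a' * r ^ 2 / 2 ≤ inner ℝ (p - w) g := by
    have h1 : inner ℝ (p - w) g = inner ℝ (p - w) (g - a' • (p - w)) + a' * r ^ 2 := by
      rw [inner_sub_right, inner_smul_right, real_inner_self_eq_norm_sq]; ring
    have h2 := neg_le_of_abs_le (abs_real_inner_le_norm (p - w) (g - a' • (p - w)))
    have h3 : ‖p - w‖ * ‖g - a' • (p - w)‖ ≤ r * (a' * r / 2) := by gcongr
    linarith
  have hκ : 0 < ε / δ := by positivity
  have hκ1 : ε / δ ≤ 1 := by rwa [div_le_one hδ]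
  have har : 6 ≤ a' * r := ha6.trans (by gcongr)
  have hden : 0 < ‖g‖ + ε / δ := by positivity
  have hden2 : ‖g‖ + ε / δ ≤ 2 * (a' * r) := by linarith
  -- Adding ε/δ to the denominator keeps the direction strictly inside the unit ball, and costs at
  -- most ε/δ against the optimal value −‖g‖.
  have hgm : inner ℝ g m ≤ -‖g‖ + ε / δ := by
    rw [hm, pullDir, inner_neg_right, inner_smul_right, real_inner_self_eq_norm_sq, ← hg,
      neg_le, inv_mul_eq_div, le_div_iff₀ hden]
    nlinarith
  have hρm : (r / 4) ^ 2 ≤ inner ℝ (p - w) m ^ 2 := by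
    have h1 : inner ℝ (p - w) m = -(inner ℝ (p - w) g / (‖g‖ + ε / δ)) := by
      rw [hm, pullDir, inner_neg_right, inner_smul_right, ← hg, inv_mul_eq_div]
    rw [h1, neg_sq]
    have h2 : r / 4 ≤ inner ℝ (p - w) g / (‖g‖ + ε / δ) := by
      rw [le_div_iff₀ hden]
      calc r / 4 * (‖g‖ + ε / δ) ≤ r / 4 * (2 * (a' * r)) := by gcongr
        _ = a' * r ^ 2 / 2 := by ring
        _ ≤ _ := hinner
    gcongr
  clear_value B a' g r m E3
  have hsq1 : ∀ v : Pt n, ‖v‖ ≤ 1 → (lam / δ + a') * ‖v‖ ^ 2 ≤ 2 * a' := by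
    intro v hv
    have h1 : ‖v‖ ^ 2 ≤ 1 := pow_le_one₀ (norm_nonneg _) hv
    calc (lam / δ + a') * ‖v‖ ^ 2 ≤ (lam / δ + a') * 1 := by gcongr
      _ ≤ 2 * a' := by linarith
  have ha6' : 6 * (ε ^ 2 / δ) ≤ ε ^ 2 * a' := by
    calc 6 * (ε ^ 2 / δ) = ε ^ 2 * (6 / δ) := by ring
      _ ≤ ε ^ 2 * a' := by gcongr
  have h3 : inner ℝ g s ≤ ‖g‖ := (real_inner_le_norm g s).trans
    (mul_le_of_le_one_right (norm_nonneg _) hs)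
  have h4 : ε * (inner ℝ g m + inner ℝ g s) ≤ ε ^ 2 / δ := by
    calc ε * (inner ℝ g m + inner ℝ g s) ≤ ε * (ε / δ) := by gcongr; linarith
      _ = ε ^ 2 / δ := by ring
  -- The pull has radial component at least 1/4 in size, so the concave term is at least μr²a'/8 ≥
  -- 6a'. This is where 48 comes from.
  have h5 : (lam / δ + a') * ‖m‖ ^ 2 - 2 * μ * a' * inner ℝ (p - w) m ^ 2 ≤ -4 * a' := by
    have h6 : 2 * μ * a' * (r / 4) ^ 2 ≤ 2 * μ * a' * inner ℝ (p - w) m ^ 2 := by gcongr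
    have h7 : a' * 48 ≤ a' * (μ * r ^ 2) := by gcongr; linarith
    linarith [hsq1 m hm1]
  have h8 : (lam / δ + a') * ‖s‖ ^ 2 - 2 * μ * a' * inner ℝ (p - w) s ^ 2 ≤ 2 * a' := by
    have : 0 ≤ 2 * μ * a' * inner ℝ (p - w) s ^ 2 := by positivity
    linarith [hsq1 s hs]
  -- The two second-order terms total −ε²a' ≤ −6ε²/δ. The first-order loss costs ε²/δ and the two
  -- cubic remainders 2ε²/δ, which leaves more than the required decrease.
  have h9 := mul_le_mul_of_nonneg_left h5 (by positivity : 0 ≤ ε ^ 2 / 2)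
  have h10 := mul_le_mul_of_nonneg_left h8 (by positivity : 0 ≤ ε ^ 2 / 2)
  have h11 : 0 ≤ ε ^ 2 / δ := by positivity
  linarith

/-- The mean of the barrier after a random move. -/
lemma barrier_integral_le (w z : Pt n) {δ μ A lam ε R c : ℝ} (hδ : 0 < δ) (hμ : 0 < μ)
    (hA : 0 ≤ A) (hlam : 0 ≤ lam) (hlam1 : lam ≤ 1) (hε : 0 < ε) (hεR : ε ≤ R)
    (hsmall : 3 * μ * ε * R ≤ 1)
    (herr : (2 * μ * A) * (μ * R + 14 * μ ^ 2 * R ^ 3) * ε ≤ 1 / δ)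
    (hμc : 2 ≤ μ * δ ^ 2 * c)
    (hc : ∀ v : Pt n, c * ‖v‖ ^ 2 ≤ ∫ s, inner ℝ v s ^ 2 ∂uniformBall n) (hc0 : 0 < c)
    {p : Pt n} (hpδ : δ ≤ ‖p - w‖) (hp : ‖p - w‖ ≤ R) (hslope : 6 / δ ≤ slope w μ A p) :
    ∫ v, barrier w z δ μ A lam (p + ε • v) ∂uniformBall n
      ≤ barrier w z δ μ A lam p - ε ^ 2 / δ := by
  have hT := fun (v : Pt n) hv =>
    barrier_add_smul_le w z (s := v) (lam := lam) hδ hμ hA hε hεR hsmall hp hv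
  have hBc := continuous_barrier w z δ μ A lam
  set B := barrier w z δ μ A lam
  set a' := slope w μ A p
  set g := barrierGrad w z δ μ A lam p
  set r := ‖p - w‖ with hr
  set E3 := (2 * μ * A) * (μ * R + 14 * μ ^ 2 * R ^ 3)
  have hE3ε : E3 * ε ^ 3 ≤ ε ^ 2 / δ := by
    calc E3 * ε ^ 3 = E3 * ε * ε ^ 2 := by ring
      _ ≤ 1 / δ * ε ^ 2 := by gcongr
      _ = ε ^ 2 / δ := by ring
  clear_value B a' g E3
  have ha0 : 0 < a' := lt_of_lt_of_le (by positivity) hslope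
  have hlamδ0 : 0 ≤ lam / δ := by positivity
  have hlamδ : lam / δ ≤ a' := by
    rw [div_le_iff₀ hδ] at hslope ⊢; linarith
  have hle := integral_uniformBall_le_of_le_quadratic (f := fun v => B (p + ε • v))
    (hBc.comp (by fun_prop)) (K := B p + ε ^ 2 / 2 * (2 * a') + E3 * ε ^ 3) (a := ε)
    (b := ε ^ 2 * μ * a') (g := g) (v := p - w) (fun v hv1 => by
      have h0 : ‖v‖ ^ 2 ≤ 1 := pow_le_one₀ (norm_nonneg _) hv1
      have h1 : (lam / δ + a') * ‖v‖ ^ 2 ≤ 2 * a' :=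
        calc (lam / δ + a') * ‖v‖ ^ 2 ≤ (lam / δ + a') * 1 := by gcongr
          _ ≤ 2 * a' := by linarith
      have h2 := mul_le_mul_of_nonneg_left h1 (by positivity : 0 ≤ ε ^ 2 / 2)
      linarith [hT v hv1])
  have h3 : ε ^ 2 * μ * a' * (c * r ^ 2) ≤
      ε ^ 2 * μ * a' * ∫ v, inner ℝ (p - w) v ^ 2 ∂uniformBall n :=
    mul_le_mul_of_nonneg_left (hc _) (by positivity)
  -- The concave term is at least 2ε²a' in mean, twice the convex contribution ε²a'; what remains,
  -- at least 6ε²/δ, absorbs the cubic error.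
  have h4 : ε ^ 2 * a' * 2 ≤ ε ^ 2 * a' * (μ * r ^ 2 * c) := by
    have : 2 ≤ μ * r ^ 2 * c := hμc.trans (by gcongr)
    gcongr
  have h5 : 0 ≤ ε ^ 2 / δ := by positivity
  have h6 : 6 * (ε ^ 2 / δ) ≤ ε ^ 2 * a' := by
    calc 6 * (ε ^ 2 / δ) = ε ^ 2 * (6 / δ) := by ring
      _ ≤ ε ^ 2 * a' := by gcongr
  linarith

/-! ### Integrating out the sample of one round -/

/-- Coordinates are independent, so redrawing one of them from its own law preserves the joint law;
it suffices to check this on finite boxes. This takes the place of conditional expectations. -/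
lemma map_update_gameLaw (n k : ℕ) :
    ((gameLaw n).prod (stepLaw n)).map (fun q => Function.update q.1 k q.2) = gameLaw n := by
  have hm : Measurable fun q : (ℕ → ℝ × Pt n) × (ℝ × Pt n) => Function.update q.1 k q.2 :=
    measurable_update'
  refine Measure.eq_infinitePi _ fun s t ht => ?_
  rw [Measure.map_apply hm (.pi s.countable_toSet fun i _ => ht i)]
  by_cases hk : k ∈ s
  · have : (fun q : (ℕ → ℝ × Pt n) × (ℝ × Pt n) => Function.update q.1 k q.2) ⁻¹' (s : Set ℕ).pi t =
        ((s.erase k : Finset ℕ) : Set ℕ).pi t ×ˢ t k := by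
      ext q
      simp only [mem_preimage, Set.mem_pi, mem_prod, Finset.mem_coe, Finset.mem_erase]
      constructor
      · refine fun h => ⟨fun i hi => ?_, ?_⟩
        · simpa [Function.update_of_ne hi.1] using h i hi.2
        · simpa using h k hk
      · rintro ⟨h1, h2⟩ i hi
        rcases eq_or_ne i k with rfl | hik
        · simpa using h2
        · simpa [Function.update_of_ne hik] using h1 i ⟨hik, hi⟩
    rw [this, Measure.prod_prod, gameLaw, Measure.infinitePi_pi _ (fun i _ => ht i), mul_comm]
    exact Finset.mul_prod_erase s (fun i => stepLaw n (t i)) hk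
  · have : (fun q : (ℕ → ℝ × Pt n) × (ℝ × Pt n) => Function.update q.1 k q.2) ⁻¹' (s : Set ℕ).pi t =
        (s : Set ℕ).pi t ×ˢ univ := by
      ext q
      simp only [mem_preimage, Set.mem_pi, mem_prod, Finset.mem_coe, mem_univ, and_true]
      refine forall₂_congr fun i hi => ?_
      rw [Function.update_of_ne (ne_of_mem_of_not_mem hi hk)]
    rw [this, Measure.prod_prod, gameLaw, Measure.infinitePi_pi _ (fun i _ => ht i), measure_univ,
      mul_one]

instance : IsProbabilityMeasure (gameLaw n) := by
  unfold gameLaw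
  infer_instance

/-- The sample of a single round may be integrated out first. -/
lemma integral_gameLaw_eq_integral_update (k : ℕ) {f : (ℕ → ℝ × Pt n) → ℝ}
    (hf : Integrable f (gameLaw n)) :
    ∫ ω, f ω ∂gameLaw n = ∫ ω, ∫ e, f (Function.update ω k e) ∂stepLaw n ∂gameLaw n := by
  have hm : AEMeasurable (fun q : (ℕ → ℝ × Pt n) × (ℝ × Pt n) => Function.update q.1 k q.2)
      ((gameLaw n).prod (stepLaw n)) :=
    measurable_update'.aemeasurable
  rw [← map_update_gameLaw n k] at hf
  conv_lhs => rw [← map_update_gameLaw n k]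
  rw [integral_map hm hf.aestronglyMeasurable]
  exact integral_prod _ (hf.comp_aemeasurable hm)

lemma ae_gameLaw_noise_mem :
    ∀ᵐ ω ∂gameLaw n, ∀ k, (ω k).2 ∈ Metric.ball (0 : Pt n) 1 := by
  have h : ∀ᵐ e ∂stepLaw n, e.2 ∈ Metric.ball (0 : Pt n) 1 :=
    Measure.quasiMeasurePreserving_snd.ae ae_uniformBall_mem
  refine ae_all_iff.2 fun k => ?_
  exact (measurePreserving_eval_infinitePi (fun _ : ℕ => stepLaw n) k).quasiMeasurePreserving.ae h

lemma measurable_turnOf (α : ℝ) : Measurable (turnOf α) :=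
  Measurable.ite measurableSet_Iio measurable_const
    (Measurable.ite measurableSet_Iio measurable_const measurable_const)

lemma real_cond_Icc_Iio {a : ℝ} (h0 : 0 ≤ a) (h1 : a ≤ 1) :
    (ProbabilityTheory.cond (volume : Measure ℝ) (Icc (0 : ℝ) 1)).real (Iio a) = a := by
  have : Icc (0 : ℝ) 1 ∩ Iio a = Ico 0 a := by
    ext x; simp only [mem_inter_iff, mem_Icc, mem_Iio, mem_Ico]
    constructor
    · rintro ⟨⟨h, -⟩, h'⟩; exact ⟨h, h'⟩
    · rintro ⟨h, h'⟩; exact ⟨⟨h, (h'.trans_le h1).le⟩, h'⟩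
  rw [Measure.real, ProbabilityTheory.cond_apply measurableSet_Icc, this]
  simp [h0]

/-- The mean over one sample of a function of the turn and the random direction. -/
lemma integral_stepLaw_turnOf {α : ℝ} (h0 : 0 ≤ α) (h1 : α ≤ 1) {f : Turn → Pt n → ℝ}
    (hI : ∀ v, f Turn.playerI v = f Turn.playerI 0)
    (hII : ∀ v, f Turn.playerII v = f Turn.playerII 0)
    (hr : Integrable (f Turn.random) (uniformBall n)) :
    ∫ e, f (turnOf α e.1) e.2 ∂stepLaw n =
      α / 2 * (f Turn.playerI 0 + f Turn.playerII 0)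
        + (1 - α) * ∫ v, f Turn.random v ∂uniformBall n := by
  set ν := ProbabilityTheory.cond (volume : Measure ℝ) (Icc (0 : ℝ) 1) with hν
  have : IsProbabilityMeasure ν :=
    ProbabilityTheory.cond_isProbabilityMeasure_of_finite (by simp) (by simp)
  have hstep : stepLaw n = ν.prod (uniformBall n) := rfl
  set i₁ : ℝ → ℝ := (Iio (α / 2)).indicator 1
  set i₂ : ℝ → ℝ := (Iio α).indicator 1
  have hi₁ : Integrable i₁ ν := (integrable_const (1 : ℝ)).indicator measurableSet_Iio
  have hi₂ : Integrable i₂ ν := (integrable_const (1 : ℝ)).indicator measurableSet_Iio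
  have hi₂₁ : Integrable (fun ξ => i₂ ξ - i₁ ξ) ν := hi₂.sub hi₁
  have hint₁ : ∫ ξ, i₁ ξ ∂ν = α / 2 := by
    rw [integral_indicator_one measurableSet_Iio, real_cond_Icc_Iio (by linarith) (by linarith)]
  have hint₂ : ∫ ξ, i₂ ξ ∂ν = α := by
    rw [integral_indicator_one measurableSet_Iio, real_cond_Icc_Iio h0 h1]
  -- Indicators of {ξ < α/2} and {ξ < α} write the integrand as a function of ξ plus a product of a
  -- function of ξ and one of the direction.
  have hf : ∀ e : ℝ × Pt n, f (turnOf α e.1) e.2 =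
      (f Turn.playerI 0 * i₁ e.1 + f Turn.playerII 0 * (i₂ e.1 - i₁ e.1))
        + (1 - i₂ e.1) * f Turn.random e.2 := by
    intro e
    simp only [turnOf, i₁, i₂, indicator_apply, mem_Iio, Pi.one_apply]
    by_cases ha : e.1 < α / 2
    · have hb : e.1 < α := by linarith
      simp [ha, hb, hI e.2]
    · by_cases hb : e.1 < α
      · simp [ha, hb, hII e.2]
      · simp [ha, hb]
  have hA : Integrable (fun e : ℝ × Pt n =>
      f Turn.playerI 0 * i₁ e.1 + f Turn.playerII 0 * (i₂ e.1 - i₁ e.1))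
      (ν.prod (uniformBall n)) :=
    ((hi₁.const_mul _).add (hi₂₁.const_mul _)).comp_fst (uniformBall n)
  have hB : Integrable (fun e : ℝ × Pt n => (1 - i₂ e.1) * f Turn.random e.2)
      (ν.prod (uniformBall n)) :=
    ((integrable_const (1 : ℝ)).sub hi₂).mul_prod hr
  simp only [hf]
  rw [hstep, integral_add hA hB, integral_prod_mul (fun ξ => 1 - i₂ ξ),
    integral_fun_fst (fun ξ => f Turn.playerI 0 * i₁ ξ + f Turn.playerII 0 * (i₂ ξ - i₁ ξ)),
    integral_add (hi₁.const_mul _) (hi₂₁.const_mul _), integral_const_mul,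
    integral_const_mul, integral_sub hi₂ hi₁, integral_sub (integrable_const _) hi₂, hint₁, hint₂]
  simp
  ring

/-! ### The stopped process and its supermartingale inequality -/

section StoppedGame

variable (Ω : Set (Pt n)) (α ε : ℝ) (SI SII : Strategy n) (x₀ : Pt n)

/-- Strategies do not anticipate: the history after `k` rounds uses only samples of index below `k`,
so sample `k` may be redrawn without affecting it. -/
lemma history_congr {ω ω' : ℕ → ℝ × Pt n} :
    ∀ k, (∀ i < k, ω i = ω' i) → history α ε SI SII x₀ ω k = history α ε SI SII x₀ ω' k
  | 0, _ => rfl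
  | k + 1, h => by
    have ih := history_congr (ω := ω) (ω' := ω') k fun i hi => h i (hi.trans (Nat.lt_succ_self k))
    simp only [history, ih, h k (Nat.lt_succ_self k)]

lemma position_update {ω : ℕ → ℝ × Pt n} {j k : ℕ} (hjk : j ≤ k) (e : ℝ × Pt n) :
    position α ε SI SII x₀ (Function.update ω k e) j = position α ε SI SII x₀ ω j := by
  rw [position, position, history_congr α ε SI SII x₀ j fun i hi =>
    Function.update_of_ne (hi.trans_le hjk).ne e ω]

lemma position_succ (ω : ℕ → ℝ × Pt n) (k : ℕ) :
    position α ε SI SII x₀ ω (k + 1) =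
      nextPos ε SI SII x₀ k (history α ε SI SII x₀ ω k) (turnOf α (ω k).1) (ω k).2 := by
  simp [position, lastPos, history]

lemma measurable_lastPos : ∀ k, Measurable (lastPos (n := n) x₀ k)
  | 0 => measurable_const
  | k + 1 => by unfold lastPos; fun_prop

lemma nextPos_eq (k : ℕ) (h : Hist n k) (c : Turn) (v : Pt n) :
    nextPos ε SI SII x₀ k h c v = lastPos x₀ k h + ε • (match c with
      | Turn.playerI => SI.move k (x₀, h)
      | Turn.playerII => SII.move k (x₀, h)
      | Turn.random => v) := by
  cases c <;> rfl

lemma measurable_nextPos (k : ℕ) :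
    Measurable fun q : Turn × Hist n k × Pt n => nextPos ε SI SII x₀ k q.2.1 q.1 q.2.2 := by
  have : Countable Turn := by
    refine (Function.Surjective.countable
      (f := fun i : Fin 3 => ![Turn.playerI, Turn.playerII, Turn.random] i)) fun c => ?_
    cases c
    exacts [⟨0, rfl⟩, ⟨1, rfl⟩, ⟨2, rfl⟩]
  have h0 := measurable_lastPos (n := n) x₀ k
  have h1 := SI.measurable_move k
  have h2 := SII.measurable_move k
  refine measurable_from_prod_countable_right fun c => ?_
  cases c <;> simp only [nextPos] <;> fun_prop

lemma measurable_history : ∀ k, Measurable fun ω => history α ε SI SII x₀ ω k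
  | 0 => measurable_const
  | k + 1 => by
    have ih := measurable_history k
    have hc : Measurable fun ω : ℕ → ℝ × Pt n => turnOf α (ω k).1 :=
      (measurable_turnOf α).comp (by fun_prop)
    refine measurable_pi_iff.2 fun i => ?_
    refine Fin.lastCases ?_ (fun j => ?_) i
    · simp only [history, Fin.snoc_last]
      exact hc.prodMk ((measurable_nextPos ε SI SII x₀ k).comp
        (hc.prodMk (ih.prodMk (by fun_prop : Measurable fun ω : ℕ → ℝ × Pt n => (ω k).2))))
    · simp only [history, Fin.snoc_castSucc]
      exact (measurable_pi_apply j).comp ih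

lemma measurable_position (k : ℕ) : Measurable fun ω => position α ε SI SII x₀ ω k :=
  (measurable_lastPos x₀ k).comp (measurable_history α ε SI SII x₀ k)

lemma norm_position_succ_sub_lt (hε : 0 < ε) {ω : ℕ → ℝ × Pt n} {k : ℕ}
    (hω : (ω k).2 ∈ Metric.ball (0 : Pt n) 1) :
    ‖position α ε SI SII x₀ ω (k + 1) - position α ε SI SII x₀ ω k‖ < ε := by
  have key : ∀ v ∈ Metric.ball (0 : Pt n) 1, ‖ε • v‖ < ε := fun v hv => by
    rw [norm_smul, Real.norm_of_nonneg hε.le]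
    exact mul_lt_of_lt_one_right hε (mem_ball_zero_iff.1 hv)
  rw [position_succ, nextPos_eq, position, add_sub_cancel_left]
  cases turnOf α (ω k).1
  · exact key _ (SI.move_mem _ _)
  · exact key _ (SII.move_mem _ _)
  · exact key _ hω

/-- The game has not ended after `k` rounds. -/
def Running (k : ℕ) (ω : ℕ → ℝ × Pt n) : Prop :=
  ∀ j ≤ k, position α ε SI SII x₀ ω j ∉ outerStrip Ω ε

lemma measurableSet_outerStrip (hΩ : IsOpen Ω) : MeasurableSet (outerStrip Ω ε) :=
  hΩ.measurableSet.compl.inter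
    (measurableSet_le (Metric.continuous_infDist_pt _).measurable measurable_const)

lemma measurableSet_running (hΩ : IsOpen Ω) (k : ℕ) :
    MeasurableSet {ω | Running Ω α ε SI SII x₀ k ω} := by
  have : {ω | Running Ω α ε SI SII x₀ k ω} =
      ⋂ j ∈ Finset.range (k + 1), (fun ω => position α ε SI SII x₀ ω j) ⁻¹' (outerStrip Ω ε)ᶜ := by
    ext ω
    simp [Running]
  rw [this]
  exact Finset.measurableSet_biInter _ fun j _ =>
    measurable_position α ε SI SII x₀ j (measurableSet_outerStrip Ω ε hΩ).compl

variable {Ω} in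
/-- A step shorter than `ε` from a point of `Ω` cannot jump over the outer strip. -/
lemma mem_outerStrip_of_norm_sub_le (hΩ : IsOpen Ω) {p q : Pt n} (hp : p ∈ Ω) (hq : q ∉ Ω) (h : ‖q - p‖ ≤ ε) :
    q ∈ outerStrip Ω ε := by
  refine ⟨hq, ?_⟩
  -- A segment that avoids the frontier would be disconnected by Ω and the complement of its
  -- closure.
  obtain ⟨b, hb, hbf⟩ : (segment ℝ p q ∩ frontier Ω).Nonempty := by
    by_contra hcon
    have hout : ∀ b ∈ segment ℝ p q, b ∉ Ω → b ∈ (closure Ω)ᶜ := fun b hb hbΩ hbc =>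
      hcon ⟨b, hb, by rw [hΩ.frontier_eq]; exact ⟨hbc, hbΩ⟩⟩
    obtain ⟨b, -, hb1, hb2⟩ := (convex_segment p q).isPreconnected Ω (closure Ω)ᶜ hΩ
      isClosed_closure.isOpen_compl
      (fun b hb => (em (b ∈ Ω)).imp_right (hout b hb))
      ⟨p, left_mem_segment ℝ p q, hp⟩
      ⟨q, right_mem_segment ℝ p q, hout q (right_mem_segment ℝ p q) hq⟩
    exact hb2 (subset_closure hb1)
  refine (Metric.infDist_le_dist_of_mem hbf).trans ?_
  have h1 := dist_add_dist_of_mem_segment hb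
  have h2 : dist p q ≤ ε := by rwa [dist_eq_norm_sub']
  linarith [dist_comm q b, dist_nonneg (x := p) (y := b)]

-- Points outside the strip could also lie far from Ω; induction on the rounds excludes this, since
-- each step is shorter than ε.
variable {Ω} in
lemma position_mem_of_running (hΩ : IsOpen Ω) (hε : 0 < ε) (hx₀ : x₀ ∈ Ω) {ω : ℕ → ℝ × Pt n}
    (hω : ∀ k, (ω k).2 ∈ Metric.ball (0 : Pt n) 1) :
    ∀ k, Running Ω α ε SI SII x₀ k ω → position α ε SI SII x₀ ω k ∈ Ω
  | 0, _ => hx₀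
  | k + 1, h => by
    by_contra hcon
    refine h (k + 1) le_rfl (mem_outerStrip_of_norm_sub_le ε hΩ
      (position_mem_of_running hΩ hε hx₀ hω k fun j hj => h j (hj.trans (Nat.le_succ k))) hcon ?_)
    exact (norm_position_succ_sub_lt α ε SI SII x₀ hε (hω k)).le

open scoped Classical in
/-- The increment in round `k + 1` of the stopped process `V(X_{k ∧ τ}) + c (k ∧ τ)`. -/
def stoppedIncr (V : Pt n → ℝ) (c : ℝ) (k : ℕ) (ω : ℕ → ℝ × Pt n) : ℝ :=
  if Running Ω α ε SI SII x₀ k ω then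
    V (position α ε SI SII x₀ ω (k + 1)) - V (position α ε SI SII x₀ ω k) + c
  else 0

/-- The stopped process `V(X_{k ∧ τ}) + c (k ∧ τ)`. -/
def stoppedProcess (V : Pt n → ℝ) (c : ℝ) (k : ℕ) (ω : ℕ → ℝ × Pt n) : ℝ :=
  V x₀ + ∑ j ∈ Finset.range k, stoppedIncr Ω α ε SI SII x₀ V c j ω

/-- The increments telescope. Only positions before `k` need avoid the strip, so the formula also
covers the exit round. -/
lemma stoppedProcess_of_forall_notMem (V : Pt n → ℝ) (c : ℝ) (ω : ℕ → ℝ × Pt n) :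
    ∀ k, (∀ j < k, position α ε SI SII x₀ ω j ∉ outerStrip Ω ε) →
      stoppedProcess Ω α ε SI SII x₀ V c k ω = V (position α ε SI SII x₀ ω k) + k * c
  | 0, _ => by simp [stoppedProcess, position, lastPos]
  | k + 1, h => by
    have ih := stoppedProcess_of_forall_notMem V c ω k fun j hj => h j (hj.trans (Nat.lt_succ_self k))
    have hrun : Running Ω α ε SI SII x₀ k ω := fun j hj => h j (Nat.lt_succ_iff.2 hj)
    rw [stoppedProcess, Finset.sum_range_succ, ← add_assoc, ← stoppedProcess, ih, stoppedIncr,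
      if_pos hrun]
    push_cast
    ring

lemma stoppedProcess_of_mem (V : Pt n → ℝ) (c : ℝ) {ω : ℕ → ℝ × Pt n} {j : ℕ}
    (hj : ∀ i < j, position α ε SI SII x₀ ω i ∉ outerStrip Ω ε)
    (hmem : position α ε SI SII x₀ ω j ∈ outerStrip Ω ε) {k : ℕ} (hjk : j ≤ k) :
    stoppedProcess Ω α ε SI SII x₀ V c k ω = V (position α ε SI SII x₀ ω j) + j * c := by
  induction k, hjk using Nat.le_induction with
  | base => exact stoppedProcess_of_forall_notMem Ω α ε SI SII x₀ V c ω j hj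
  | succ k hk ih =>
    rw [stoppedProcess, Finset.sum_range_succ, ← add_assoc, ← stoppedProcess, ih, stoppedIncr,
      if_neg fun h => h j hk hmem, add_zero]

variable {Ω α ε SI SII x₀}

lemma integrable_stoppedIncr (hΩ : IsOpen Ω) (hb : Bornology.IsBounded Ω) (hε : 0 < ε)
    (hx₀ : x₀ ∈ Ω) {V : Pt n → ℝ} (hV : Continuous V) (c : ℝ) (k : ℕ) :
    Integrable (stoppedIncr Ω α ε SI SII x₀ V c k) (gameLaw n) := by
  obtain ⟨r, hr⟩ := hb.subset_closedBall 0
  obtain ⟨B, hB⟩ := (isCompact_closedBall (0 : Pt n) (r + ε)).exists_bound_of_continuousOn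
    hV.continuousOn
  have hmeas : Measurable (stoppedIncr Ω α ε SI SII x₀ V c k) := by
    classical
    refine Measurable.ite (measurableSet_running Ω α ε SI SII x₀ hΩ k) ?_ measurable_const
    exact ((hV.measurable.comp (measurable_position α ε SI SII x₀ (k + 1))).sub
      (hV.measurable.comp (measurable_position α ε SI SII x₀ k))).add_const c
  refine Integrable.of_bound hmeas.aestronglyMeasurable (|B| + |B| + |c|) ?_
  filter_upwards [ae_gameLaw_noise_mem] with ω hω
  rw [stoppedIncr]
  split_ifs with hrun
  · have hk := position_mem_of_running α ε SI SII x₀ hΩ hε hx₀ hω k hrun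
    have hk' := mem_closedBall_zero_iff.1 (hr hk)
    have hs := norm_position_succ_sub_lt α ε SI SII x₀ hε (hω k)
    have h1 := hB (position α ε SI SII x₀ ω k) (mem_closedBall_zero_iff.2 (by linarith))
    have h2 := hB (position α ε SI SII x₀ ω (k + 1)) (mem_closedBall_zero_iff.2 (by
      linarith [norm_sub_norm_le (position α ε SI SII x₀ ω (k + 1)) (position α ε SI SII x₀ ω k)]))
    refine (norm_add_le _ _).trans (add_le_add ((norm_sub_le _ _).trans (add_le_add ?_ ?_)) le_rfl)
    · exact h2.trans (le_abs_self B)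
    · exact h1.trans (le_abs_self B)
  · rw [norm_zero]; positivity

lemma integrable_stoppedProcess (hΩ : IsOpen Ω) (hb : Bornology.IsBounded Ω) (hε : 0 < ε)
    (hx₀ : x₀ ∈ Ω) {V : Pt n → ℝ} (hV : Continuous V) (c : ℝ) (k : ℕ) :
    Integrable (stoppedProcess Ω α ε SI SII x₀ V c k) (gameLaw n) :=
  (integrable_const _).add (integrable_finsetSum _ fun j _ =>
    integrable_stoppedIncr hΩ hb hε hx₀ hV c j)

/-- A discrete supermartingale inequality for the game. -/
lemma integral_stoppedProcess_le (hΩ : IsOpen Ω) (hb : Bornology.IsBounded Ω) (hε : 0 < ε)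
    (hα0 : 0 ≤ α) (hα1 : α ≤ 1) (hx₀ : x₀ ∈ Ω) {V : Pt n → ℝ} (hV : Continuous V) {c : ℝ}
    (hdrift : ∀ k (h : Hist n k), lastPos x₀ k h ∈ Ω →
      α / 2 * (V (lastPos x₀ k h + ε • SI.move k (x₀, h))
          + V (lastPos x₀ k h + ε • SII.move k (x₀, h)))
        + (1 - α) * ∫ v, V (lastPos x₀ k h + ε • v) ∂uniformBall n ≤ V (lastPos x₀ k h) - c)
    (k : ℕ) :
    ∫ ω, stoppedProcess Ω α ε SI SII x₀ V c k ω ∂gameLaw n ≤ V x₀ := by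
  have hincr : ∀ j, ∫ ω, stoppedIncr Ω α ε SI SII x₀ V c j ω ∂gameLaw n ≤ 0 := by
    intro j
    -- Redrawing sample `j` changes neither whether the game is running nor the history at round
    -- `j`, so the inner integral is the one-round drift at a fixed history.
    rw [integral_gameLaw_eq_integral_update j (integrable_stoppedIncr hΩ hb hε hx₀ hV c j)]
    refine integral_nonpos_of_ae ?_
    filter_upwards [ae_gameLaw_noise_mem] with ω hω
    have hrun : ∀ e, Running Ω α ε SI SII x₀ j (Function.update ω j e) ↔
        Running Ω α ε SI SII x₀ j ω := fun e =>
      forall₂_congr fun i hi => by rw [position_update α ε SI SII x₀ hi]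
    have hhist : ∀ e, history α ε SI SII x₀ (Function.update ω j e) j =
        history α ε SI SII x₀ ω j := fun e =>
      history_congr α ε SI SII x₀ j fun i hi => Function.update_of_ne hi.ne e ω
    by_cases hr : Running Ω α ε SI SII x₀ j ω
    · have hval : ∀ e, stoppedIncr Ω α ε SI SII x₀ V c j (Function.update ω j e) =
          V (nextPos ε SI SII x₀ j (history α ε SI SII x₀ ω j) (turnOf α e.1) e.2)
            - V (position α ε SI SII x₀ ω j) + c := fun e => by
        rw [stoppedIncr, if_pos ((hrun e).2 hr), position_succ, hhist,
          position_update α ε SI SII x₀ le_rfl, Function.update_self]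
      simp only [hval]
      have hp := position_mem_of_running α ε SI SII x₀ hΩ hε hx₀ hω j hr
      set h := history α ε SI SII x₀ ω j with hh
      have hd := hdrift j h hp
      change _ ≤ (0 : ℝ)
      rw [integral_stepLaw_turnOf hα0 hα1 (f := fun t v =>
        V (nextPos ε SI SII x₀ j h t v) - V (position α ε SI SII x₀ ω j) + c)
        (fun _ => rfl) (fun _ => rfl)]
      · simp only [nextPos_eq]
        have hVi : Integrable (fun v => V (lastPos x₀ j h + ε • v)) (uniformBall n) :=
          integrable_uniformBall_of_continuous (by fun_prop)
        have hVi' : Integrable (fun v => V (lastPos x₀ j h + ε • v)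
            - V (position α ε SI SII x₀ ω j)) (uniformBall n) := hVi.sub (integrable_const _)
        rw [integral_add hVi' (integrable_const _),
          integral_sub hVi (integrable_const _)]
        simp only [integral_const, probReal_univ, one_smul]
        have hpos : position α ε SI SII x₀ ω j = lastPos x₀ j h := rfl
        rw [hpos]
        linarith
      · simp only [nextPos_eq]
        exact integrable_uniformBall_of_continuous (by fun_prop)
    · have hval : ∀ e, stoppedIncr Ω α ε SI SII x₀ V c j (Function.update ω j e) = 0 := fun e => by
        rw [stoppedIncr, if_neg fun h => hr ((hrun e).1 h)]
      simp [hval]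
  unfold stoppedProcess
  rw [integral_add (integrable_const _) (integrable_finsetSum _ fun j _ =>
      integrable_stoppedIncr hΩ hb hε hx₀ hV c j), integral_const, probReal_univ, one_smul,
    integral_finsetSum _ fun j _ => integrable_stoppedIncr hΩ hb hε hx₀ hV c j]
  linarith [Finset.sum_nonpos fun j (_ : j ∈ Finset.range k) => hincr j]

end StoppedGame

/-! ### The pulling strategy, the payoff and the two values -/

lemma measurable_lastPos_uncurry (k : ℕ) :
    Measurable fun q : Pt n × Hist n k => lastPos q.1 k q.2 := by
  cases k with
  | zero => exact measurable_fst
  | succ k => unfold lastPos; fun_prop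

/-- The strategy that always moves in the direction `pullDir`. -/
def pullStrategy (w z : Pt n) {δ ε : ℝ} (μ A lam : ℝ) (hδ : 0 < δ) (hε : 0 < ε) : Strategy n where
  move k q := pullDir w z δ μ A lam ε (lastPos q.1 k q.2)
  measurable_move k := (measurable_pullDir w z δ μ A lam ε).comp (measurable_lastPos_uncurry k)
  move_mem _ _ := mem_ball_zero_iff.2 (norm_pullDir_lt_one w z μ A lam hδ hε _)

instance : Nonempty (Strategy n) :=
  ⟨⟨fun _ _ => 0, fun _ => measurable_const, fun _ _ => by simp⟩⟩

section Payoff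

variable {Ω : Set (Pt n)} {F : Pt n → ℝ} {α γ ε M : ℝ}

lemma measurable_payoff (hΩ : IsOpen Ω) (hF : ContinuousOn F (outerStrip Ω ε))
    (SI SII : Strategy n) (x₀ : Pt n) : Measurable (payoff Ω F α γ ε SI SII x₀) := by
  classical
  have hS := measurableSet_outerStrip Ω ε hΩ
  have hFm : Measurable ((outerStrip Ω ε).indicator F) := by
    rw [← piecewise_eq_indicator]
    exact hF.measurable_piecewise continuousOn_const hS
  set X := position α ε SI SII x₀
  have hXm : ∀ k, Measurable fun ω => X ω k := measurable_position α ε SI SII x₀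
  -- The second alternative makes the search total. In a game that never ends it returns 0, where
  -- the indicator vanishes, in agreement with the default payoff.
  let P : ℕ → (ℕ → ℝ × Pt n) → Prop := fun k ω =>
    X ω k ∈ outerStrip Ω ε ∨ ¬ ∃ j, X ω j ∈ outerStrip Ω ε
  have hP : ∀ ω, ∃ k, P k ω := fun ω => by
    by_cases h : ∃ j, X ω j ∈ outerStrip Ω ε
    · exact h.imp fun _ => Or.inl
    · exact ⟨0, Or.inr h⟩
  have hPm : ∀ k, MeasurableSet {ω | P k ω} := fun k => by
    refine (hXm k hS).union 
      (MeasurableSet.compl (s := {ω | ∃ j, X ω j ∈ outerStrip Ω ε}) ?_)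
    have : {ω | ∃ j, X ω j ∈ outerStrip Ω ε} = ⋃ j, (fun ω => X ω j) ⁻¹' outerStrip Ω ε := by
      ext; simp
    rw [this]
    exact MeasurableSet.iUnion fun j => hXm j hS
  have hmeas := Measurable.find (f := fun k ω =>
    (1 - γ * ε ^ 2) ^ k * (outerStrip Ω ε).indicator F (X ω k))
    (fun k => (hFm.comp (hXm k)).const_mul _) hPm hP
  convert hmeas using 1
  ext ω
  by_cases h : ∃ j, X ω j ∈ outerStrip Ω ε
  · have hfind : Nat.find h = Nat.find (hP ω) :=
      Nat.find_congr' fun {k} => ⟨Or.inl, fun hk => hk.resolve_right (not_not_intro h)⟩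
    rw [payoff, dif_pos h, ← hfind, indicator_of_mem (Nat.find_spec h)]
  · rw [payoff, dif_neg h, indicator_of_notMem (fun hmem => h ⟨_, hmem⟩), mul_zero]

lemma abs_payoff_le (hd0 : 0 ≤ 1 - γ * ε ^ 2) (hd1 : 1 - γ * ε ^ 2 ≤ 1) (hM0 : 0 ≤ M)
    (hM : ∀ p ∈ outerStrip Ω ε, |F p| ≤ M) (SI SII : Strategy n) (x₀ : Pt n)
    (ω : ℕ → ℝ × Pt n) : |payoff Ω F α γ ε SI SII x₀ ω| ≤ M := by
  classical
  rw [payoff]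
  split_ifs with h
  · rw [abs_mul, abs_of_nonneg (pow_nonneg hd0 _)]
    exact (mul_le_of_le_one_left (abs_nonneg _) (pow_le_one₀ hd0 hd1)).trans
      (hM _ (Nat.find_spec h))
  · rwa [abs_zero]

lemma abs_expectedPayoff_le (hd0 : 0 ≤ 1 - γ * ε ^ 2) (hd1 : 1 - γ * ε ^ 2 ≤ 1) (hM0 : 0 ≤ M)
    (hM : ∀ p ∈ outerStrip Ω ε, |F p| ≤ M) (SI SII : Strategy n) (x₀ : Pt n) :
    |expectedPayoff Ω F α γ ε SI SII x₀| ≤ M := by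
  have h := norm_integral_le_of_norm_le_const (μ := gameLaw n) (C := M)
    (f := payoff Ω F α γ ε SI SII x₀)
    (ae_of_all _ fun ω => abs_payoff_le (α := α) hd0 hd1 hM0 hM SI SII x₀ ω)
  simpa [expectedPayoff] using h

lemma expectedPayoff_of_mem_outerStrip (SI SII : Strategy n) {z : Pt n}
    (hz : z ∈ outerStrip Ω ε) : expectedPayoff Ω F α γ ε SI SII z = F z := by
  classical
  have hp : ∀ ω, payoff Ω F α γ ε SI SII z ω = F z := fun ω => by
    have h : ∃ k, position α ε SI SII z ω k ∈ outerStrip Ω ε := ⟨0, hz⟩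
    have h0 : Nat.find h = 0 := (Nat.find_eq_zero h).2 hz
    rw [payoff, dif_pos h, h0, pow_zero, one_mul]
    rfl
  simp [expectedPayoff, hp]

lemma valueI_of_mem_outerStrip {z : Pt n} (hz : z ∈ outerStrip Ω ε) :
    valueI Ω F α γ ε z = F z := by
  simp [valueI, expectedPayoff_of_mem_outerStrip _ _ hz]

lemma valueII_of_mem_outerStrip {z : Pt n} (hz : z ∈ outerStrip Ω ε) :
    valueII Ω F α γ ε z = F z := by
  simp [valueII, expectedPayoff_of_mem_outerStrip _ _ hz]

/-- If each player has a strategy which keeps the expected payoff near `a`, whatever the opponent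
does, then both values are near `a`. -/
lemma abs_value_sub_le {x₀ : Pt n} {a b : ℝ} {SI' SII' : Strategy n}
    (hM : ∀ SI SII, |expectedPayoff Ω F α γ ε SI SII x₀| ≤ M)
    (hI : ∀ SII, |expectedPayoff Ω F α γ ε SI' SII x₀ - a| ≤ b)
    (hII : ∀ SI, |expectedPayoff Ω F α γ ε SI SII' x₀ - a| ≤ b) :
    |valueI Ω F α γ ε x₀ - a| ≤ b ∧ |valueII Ω F α γ ε x₀ - a| ≤ b := by
  have hbelow : ∀ SI, BddBelow (range fun SII => expectedPayoff Ω F α γ ε SI SII x₀) := fun SI =>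
    ⟨-M, by rintro _ ⟨SII, rfl⟩; exact neg_le_of_abs_le (hM SI SII)⟩
  have habove : ∀ SII, BddAbove (range fun SI => expectedPayoff Ω F α γ ε SI SII x₀) := fun SII =>
    ⟨M, by rintro _ ⟨SI, rfl⟩; exact le_of_abs_le (hM SI SII)⟩
  have hI1 : BddAbove (range fun SI => ⨅ SII, expectedPayoff Ω F α γ ε SI SII x₀) :=
    ⟨M, by
      rintro _ ⟨SI, rfl⟩
      exact (ciInf_le (hbelow SI) SII').trans (le_of_abs_le (hM SI SII'))⟩
  have hII1 : BddBelow (range fun SII => ⨆ SI, expectedPayoff Ω F α γ ε SI SII x₀) :=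
    ⟨-M, by
      rintro _ ⟨SII, rfl⟩
      exact (neg_le_of_abs_le (hM SI' SII)).trans (le_ciSup (habove SII) SI')⟩
  have hlow : ∀ SII, a - b ≤ expectedPayoff Ω F α γ ε SI' SII x₀ := fun SII => by
    linarith [neg_le_of_abs_le (hI SII)]
  have hupp : ∀ SI, expectedPayoff Ω F α γ ε SI SII' x₀ ≤ a + b := fun SI => by
    linarith [le_of_abs_le (hII SI)]
  -- Each value is bounded below by fixing `SI'` and above by fixing `SII'`.
  have h1 : a - b ≤ valueI Ω F α γ ε x₀ := le_ciSup_of_le hI1 SI' (le_ciInf hlow)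
  have h2 : valueI Ω F α γ ε x₀ ≤ a + b :=
    ciSup_le fun SI => (ciInf_le (hbelow SI) SII').trans (hupp SI)
  have h3 : valueII Ω F α γ ε x₀ ≤ a + b := ciInf_le_of_le hII1 SII' (ciSup_le hupp)
  have h4 : a - b ≤ valueII Ω F α γ ε x₀ :=
    le_ciInf fun SII => (hlow SII).trans (le_ciSup (habove SII) SI')
  exact ⟨abs_le.2 ⟨by linarith, by linarith⟩, abs_le.2 ⟨by linarith, by linarith⟩⟩

end Payoff

/-! ### From the barrier to the expected payoff -/

section Estimates

lemma exp_neg_sub_exp_neg_le {a b : ℝ} (ha : 0 ≤ a) (hab : a ≤ b) :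
    Real.exp (-a) - Real.exp (-b) ≤ b - a := by
  have h1 : Real.exp (-b) = Real.exp (-a) * Real.exp (-(b - a)) := by
    rw [← Real.exp_add]; congr 1; ring
  have h2 := Real.add_one_le_exp (-(b - a))
  have h3 : Real.exp (-a) ≤ 1 := Real.exp_le_one_iff.2 (by linarith)
  have h4 : Real.exp (-a) * (-(b - a) + 1) ≤ Real.exp (-a) * Real.exp (-(b - a)) :=
    mul_le_mul_of_nonneg_left h2 (Real.exp_pos _).le
  have h5 : Real.exp (-a) * (b - a) ≤ 1 * (b - a) :=
    mul_le_mul_of_nonneg_right h3 (by linarith)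
  rw [h1]
  linarith

variable {w z : Pt n} {δ μ A lam ε : ℝ}

/-- The last step may carry the token up to ε into the exterior ball, where the exponential part is
negative; it loses at most Aμ·2δε because t ↦ e^{−t} is 1-Lipschitz on t ≥ 0. -/
lemma le_barrier (hδ : 0 < δ) (hμ : 0 ≤ μ) (hA : 0 ≤ A) (hε : 0 ≤ ε) {p : Pt n}
    (hp : δ - ε ≤ ‖p - w‖) :
    lam * ((‖p - z‖ ^ 2 + δ ^ 2) / (2 * δ)) - A * (μ * (2 * δ * ε)) ≤
      barrier w z δ μ A lam p := by
  have key : Real.exp (-(μ * ‖p - w‖ ^ 2)) - Real.exp (-(μ * δ ^ 2)) ≤ μ * (2 * δ * ε) := by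
    rcases le_total δ ‖p - w‖ with h | h
    · have h1 : μ * δ ^ 2 ≤ μ * ‖p - w‖ ^ 2 := by gcongr
      have h2 : Real.exp (-(μ * ‖p - w‖ ^ 2)) ≤ Real.exp (-(μ * δ ^ 2)) :=
        Real.exp_le_exp.2 (neg_le_neg h1)
      have h3 : 0 ≤ μ * (2 * δ * ε) := by positivity
      linarith
    · have h1 : μ * ‖p - w‖ ^ 2 ≤ μ * δ ^ 2 := by gcongr
      refine (exp_neg_sub_exp_neg_le (by positivity) h1).trans ?_
      rw [← mul_sub]
      have h2 : δ ^ 2 - ‖p - w‖ ^ 2 ≤ 2 * δ * ε := by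
        nlinarith [norm_nonneg (p - w)]
      gcongr
  have := mul_le_mul_of_nonneg_left key hA
  rw [barrier]
  linarith

lemma barrier_nonneg (hδ : 0 < δ) (hμ : 0 ≤ μ) (hA : 0 ≤ A) (hlam : 0 ≤ lam) {p : Pt n}
    (hp : δ ≤ ‖p - w‖) : 0 ≤ barrier w z δ μ A lam p := by
  have h := le_barrier (z := z) (lam := lam) hδ hμ hA le_rfl (p := p) (w := w) (by simpa using hp)
  refine le_trans ?_ h
  simp only [mul_zero, sub_zero]
  positivity

/-- In the application d = |x − y|. The value λδ at d = 0 produces the part of the final δ term that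
comes from the Lipschitz constant. -/
lemma barrier_le (hδ : 0 < δ) (hμ : 0 ≤ μ) (hA : 0 ≤ A) (hlam : 0 ≤ lam) {p : Pt n} {d R : ℝ}
    (hp : δ ≤ ‖p - w‖) (hpR : ‖p - w‖ ≤ R) (hd : ‖p - w‖ ≤ δ + d) (hz : ‖p - z‖ ≤ d + δ)
    (hd0 : 0 ≤ d) (hdR : d ≤ R + δ) :
    barrier w z δ μ A lam p ≤
      lam * (δ + (1 + (R / δ + 1) / 2) * d) + A * (μ * (2 * R * d)) := by
  have h1 : (‖p - z‖ ^ 2 + δ ^ 2) / (2 * δ) ≤ δ + (1 + (R / δ + 1) / 2) * d := by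
    calc (‖p - z‖ ^ 2 + δ ^ 2) / (2 * δ) ≤ ((d + δ) ^ 2 + δ ^ 2) / (2 * δ) := by gcongr
      _ = δ + (1 + d / (2 * δ)) * d := by field_simp; ring
      _ ≤ δ + (1 + (R + δ) / (2 * δ)) * d := by gcongr
      _ = δ + (1 + (R / δ + 1) / 2) * d := by field_simp
  have h2 : Real.exp (-(μ * δ ^ 2)) - Real.exp (-(μ * ‖p - w‖ ^ 2)) ≤ μ * (2 * R * d) := by
    have h3 : μ * δ ^ 2 ≤ μ * ‖p - w‖ ^ 2 := by gcongr
    refine (exp_neg_sub_exp_neg_le (by positivity) h3).trans ?_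
    rw [← mul_sub]
    have h4 : ‖p - w‖ ^ 2 - δ ^ 2 ≤ 2 * R * d := by
      calc ‖p - w‖ ^ 2 - δ ^ 2 = (‖p - w‖ + δ) * (‖p - w‖ - δ) := by ring
        _ ≤ (R + R) * d := by
            refine mul_le_mul (by linarith) (by linarith) (by linarith) (by linarith)
        _ = 2 * R * d := by ring
    gcongr
  rw [barrier]
  exact add_le_add (mul_le_mul_of_nonneg_left h1 hlam) (mul_le_mul_of_nonneg_left h2 hA)

/-- The cost of discounting during `j` rounds. -/
lemma one_sub_discount_pow_le {γ : ℝ} (hγ : 0 ≤ γ) (hδ : 0 < δ) (hd0 : 0 ≤ 1 - γ * ε ^ 2)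
    (j : ℕ) : 1 - (1 - γ * ε ^ 2) ^ j ≤ δ + γ * (j * (ε ^ 2 / δ)) := by
  have hj : 0 ≤ γ * (j * ε ^ 2) := by positivity
  -- For δ ≥ 1 the left side is at most 1 ≤ δ; for δ ≤ 1 Bernoulli's inequality applies and ε² ≤
  -- ε²/δ.
  rcases le_total 1 δ with h | h
  · have h1 : 0 ≤ (1 - γ * ε ^ 2) ^ j := pow_nonneg hd0 j
    have h2 : 0 ≤ γ * (j * (ε ^ 2 / δ)) := by positivity
    linarith
  · have h1 := one_add_mul_le_pow (a := -(γ * ε ^ 2)) (by linarith) j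
    rw [← sub_eq_add_neg] at h1
    have h2 : γ * (j * ε ^ 2) ≤ γ * (j * (ε ^ 2 / δ)) := by
      have : ε ^ 2 ≤ ε ^ 2 / δ := le_div_self (sq_nonneg ε) hδ h
      gcongr
    linarith

variable {Ω : Set (Pt n)} {F : Pt n → ℝ} {α γ M N : ℝ} {SI SII : Strategy n} {x : Pt n}

/-- The payoff is controlled by the stopped barrier process. -/
lemma abs_payoff_sub_le (hΩ : IsOpen Ω) (hδ : 0 < δ) (hμ : 0 ≤ μ) (hA : 0 ≤ A) (hlam : 0 ≤ lam)
    (hε : 0 < ε) (hγ : 0 ≤ γ) (hd0 : 0 ≤ 1 - γ * ε ^ 2) (hM0 : 0 ≤ M) (hMN : M * (1 + γ) ≤ N)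
    (hM : ∀ p ∈ outerStrip Ω ε, |F p| ≤ M)
    (hL : ∀ p ∈ outerStrip Ω ε, |F p - F z| ≤ N * lam * ‖p - z‖)
    (hball : ∀ p ∈ Ω, δ ≤ ‖p - w‖) (hx : x ∈ Ω) (hz : z ∈ outerStrip Ω ε)
    {ω : ℕ → ℝ × Pt n} (hω : ∀ k, (ω k).2 ∈ Metric.ball (0 : Pt n) 1)
    {k : ℕ} (hk : 2 ≤ k * (ε ^ 2 / δ)) :
    |payoff Ω F α γ ε SI SII x ω - F z| ≤
      N * stoppedProcess Ω α ε SI SII x (barrier w z δ μ A lam) (ε ^ 2 / δ) k ω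
        + M * δ + N * (A * (μ * (2 * δ * ε))) := by
  classical
  have hd1 : 1 - γ * ε ^ 2 ≤ 1 := by
    have : 0 ≤ γ * ε ^ 2 := by positivity
    linarith
  have hMN' : M ≤ N := by
    have : 0 ≤ M * γ := by positivity
    linarith
  have hN : 0 ≤ N := hM0.trans hMN'
  by_cases hex : ∃ j ≤ k, position α ε SI SII x ω j ∈ outerStrip Ω ε
  · obtain ⟨j', hj'k, hj'⟩ := hex
    have h : ∃ j, position α ε SI SII x ω j ∈ outerStrip Ω ε := ⟨j', hj'⟩
    rw [payoff, dif_pos h]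
    set j := Nat.find h with hj
    have hmem : position α ε SI SII x ω j ∈ outerStrip Ω ε := Nat.find_spec h
    have hmin : ∀ i < j, position α ε SI SII x ω i ∉ outerStrip Ω ε := fun i hi =>
      Nat.find_min h hi
    rw [stoppedProcess_of_mem Ω α ε SI SII x _ _ hmin hmem ((Nat.find_min' h hj').trans hj'k)]
    -- The position before the exit lies in Ω, hence outside the exterior ball, and the last step is
    -- shorter than ε.
    have hr : δ - ε ≤ ‖position α ε SI SII x ω j - w‖ := by
      rcases hj0 : j with _ | i
      · have := hball x hx
        simp only [position, lastPos]
        linarith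
      · have hi : position α ε SI SII x ω i ∈ Ω :=
          position_mem_of_running α ε SI SII x hΩ hε hx hω i fun i' hi' => hmin i' (by omega)
        have h1 := hball _ hi
        have h2 := norm_position_succ_sub_lt α ε SI SII x hε (hω i)
        have h3 := norm_sub_le_norm_sub_add_norm_sub (position α ε SI SII x ω i)
          (position α ε SI SII x ω (i + 1)) w
        rw [norm_sub_rev _ (position α ε SI SII x ω (i + 1))] at h3
        linarith
    generalize position α ε SI SII x ω j = p at hmem hr
    have h1 := le_barrier (z := z) (lam := lam) hδ hμ hA hε.le hr
    -- AM–GM: 2δ‖p−z‖ ≤ ‖p−z‖² + δ².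
    have h2 : ‖p - z‖ ≤ (‖p - z‖ ^ 2 + δ ^ 2) / (2 * δ) := by
      rw [le_div_iff₀ (by positivity)]
      nlinarith [sq_nonneg (‖p - z‖ - δ)]
    have h3 : N * lam * ‖p - z‖ ≤ N * lam * ((‖p - z‖ ^ 2 + δ ^ 2) / (2 * δ)) := by gcongr
    have h4 : (1 - (1 - γ * ε ^ 2) ^ j) * |F p| ≤ (δ + γ * (j * (ε ^ 2 / δ))) * M := by
      refine mul_le_mul (one_sub_discount_pow_le hγ hδ hd0 j) (hM p hmem) (abs_nonneg _) ?_
      positivity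
    -- The time term of the stopped process absorbs the part of the discounting cost that grows with
    -- `j`.
    have h5 : M * γ * (j * (ε ^ 2 / δ)) ≤ N * (j * (ε ^ 2 / δ)) := by
      have : M * γ ≤ N := by linarith
      gcongr
    have h6 : |(1 - γ * ε ^ 2) ^ j * F p - F z| ≤
        |F p - F z| + (1 - (1 - γ * ε ^ 2) ^ j) * |F p| := by
      have h7 : 0 ≤ 1 - (1 - γ * ε ^ 2) ^ j := by linarith [pow_le_one₀ hd0 hd1 (n := j)]
      calc |(1 - γ * ε ^ 2) ^ j * F p - F z|
          = |(F p - F z) - (1 - (1 - γ * ε ^ 2) ^ j) * F p| := by congr 1; ring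
        _ ≤ |F p - F z| + |(1 - (1 - γ * ε ^ 2) ^ j) * F p| := abs_sub _ _
        _ = _ := by rw [abs_mul, abs_of_nonneg h7]
    have h8 := mul_le_mul_of_nonneg_left h1 hN
    linarith [hL p hmem]
  · push Not at hex
    rw [stoppedProcess_of_forall_notMem Ω α ε SI SII x _ _ ω k fun j hj => hex j hj.le]
    have hp := position_mem_of_running α ε SI SII x hΩ hε hx hω k hex
    have h1 := barrier_nonneg (z := z) hδ hμ hA hlam (hball _ hp)
    have h2 := abs_payoff_le (α := α) hd0 hd1 hM0 hM SI SII x ω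
    have h3 := abs_sub (payoff Ω F α γ ε SI SII x ω) (F z)
    -- Still running at round `k`: the time term alone is at least 2, and 2N ≥ 2M bounds the
    -- deviation, whether the game ends later or never.
    have h4 : N * 2 ≤ N * (barrier w z δ μ A lam (position α ε SI SII x ω k)
        + k * (ε ^ 2 / δ)) := by gcongr; linarith
    have h5 : 0 ≤ M * δ := by positivity
    have h6 : 0 ≤ N * (A * (μ * (2 * δ * ε))) := by positivity
    linarith [hM z hz]

lemma abs_expectedPayoff_sub_le (hΩ : IsOpen Ω) (hb : Bornology.IsBounded Ω) (hδ : 0 < δ)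
    (hμ : 0 ≤ μ) (hA : 0 ≤ A) (hlam : 0 ≤ lam)
    (hε : 0 < ε) (hα0 : 0 ≤ α) (hα1 : α ≤ 1) (hγ : 0 ≤ γ) (hd0 : 0 ≤ 1 - γ * ε ^ 2)
    (hM0 : 0 ≤ M) (hMN : M * (1 + γ) ≤ N) (hF : ContinuousOn F (outerStrip Ω ε))
    (hM : ∀ p ∈ outerStrip Ω ε, |F p| ≤ M)
    (hL : ∀ p ∈ outerStrip Ω ε, |F p - F z| ≤ N * lam * ‖p - z‖)
    (hball : ∀ p ∈ Ω, δ ≤ ‖p - w‖) (hx : x ∈ Ω) (hz : z ∈ outerStrip Ω ε)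
    (hdrift : ∀ k (h : Hist n k), lastPos x k h ∈ Ω →
      α / 2 * (barrier w z δ μ A lam (lastPos x k h + ε • SI.move k (x, h))
          + barrier w z δ μ A lam (lastPos x k h + ε • SII.move k (x, h)))
        + (1 - α) * ∫ v, barrier w z δ μ A lam (lastPos x k h + ε • v) ∂uniformBall n
        ≤ barrier w z δ μ A lam (lastPos x k h) - ε ^ 2 / δ) :
    |expectedPayoff Ω F α γ ε SI SII x - F z| ≤
      N * barrier w z δ μ A lam x + M * δ + N * (A * (μ * (2 * δ * ε))) := by
  have hd1 : 1 - γ * ε ^ 2 ≤ 1 := by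
    have : 0 ≤ γ * ε ^ 2 := by positivity
    linarith
  have hN : 0 ≤ N := le_trans (by positivity) hMN
  -- A deterministic horizon with kε²/δ ≥ 2 replaces optional stopping at τ.
  obtain ⟨k, hk⟩ := exists_nat_ge (2 / (ε ^ 2 / δ))
  rw [div_le_iff₀ (by positivity)] at hk
  have hpi : Integrable (payoff Ω F α γ ε SI SII x) (gameLaw n) :=
    Integrable.of_bound (measurable_payoff hΩ hF SI SII x).aestronglyMeasurable M
      (ae_of_all _ fun ω => abs_payoff_le hd0 hd1 hM0 hM SI SII x ω)
  have hV := continuous_barrier w z δ μ A lam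
  set Y := stoppedProcess Ω α ε SI SII x (barrier w z δ μ A lam) (ε ^ 2 / δ) k
  have hY : Integrable Y (gameLaw n) := integrable_stoppedProcess hΩ hb hε hx hV _ k
  have hYle : ∫ ω, Y ω ∂gameLaw n ≤ barrier w z δ μ A lam x :=
    integral_stoppedProcess_le hΩ hb hε hα0 hα1 hx hV hdrift k
  have heq : expectedPayoff Ω F α γ ε SI SII x - F z =
      ∫ ω, (payoff Ω F α γ ε SI SII x ω - F z) ∂gameLaw n := by
    rw [integral_sub hpi (integrable_const _)]
    simp [expectedPayoff]
  rw [heq]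
  calc |∫ ω, (payoff Ω F α γ ε SI SII x ω - F z) ∂gameLaw n|
      ≤ ∫ ω, |payoff Ω F α γ ε SI SII x ω - F z| ∂gameLaw n := abs_integral_le_integral_abs
    _ ≤ ∫ ω, (N * Y ω + (M * δ + N * (A * (μ * (2 * δ * ε))))) ∂gameLaw n := by
        refine integral_mono_ae (hpi.sub (integrable_const _)).abs
          ((hY.const_mul N).add (integrable_const _)) ?_
        filter_upwards [ae_gameLaw_noise_mem] with ω hω
        have := abs_payoff_sub_le (α := α) (SI := SI) (SII := SII) hΩ hδ hμ hA hlam hε hγ hd0 hM0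
          hMN hM hL hball hx hz hω hk
        linarith
    _ = N * ∫ ω, Y ω ∂gameLaw n + (M * δ + N * (A * (μ * (2 * δ * ε)))) := by
        rw [integral_add (hY.const_mul N) (integrable_const _), integral_const_mul]
        simp
    _ ≤ _ := by
        have := mul_le_mul_of_nonneg_left hYle hN
        linarith

end Estimates

/-! ### The two suprema in the norm of the boundary data -/

section LipNorm

variable {Ω : Set (Pt n)} {F : Pt n → ℝ} {ε : ℝ}

/-- `infDist` to the empty set is 0, so with an empty frontier the condition on the distance would
be void; hence `hne`. -/
lemma isBounded_outerStrip (hb : Bornology.IsBounded Ω) (hne : (frontier Ω).Nonempty) :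
    Bornology.IsBounded (outerStrip Ω ε) := by
  have h : Bornology.IsBounded (Metric.thickening (ε + 1) (frontier Ω)) :=
    (hb.closure.subset frontier_subset_closure).thickening
  refine h.subset fun p hp => ?_
  exact (Metric.mem_thickening_iff_infDist_lt hne).2 (by linarith [hp.2])

/-- A real supremum over an unbounded family is 0 by default. Boundedness of `s` and some Lipschitz
constant make both families bounded above, so both suprema are genuine bounds. -/
lemma exists_lipNorm_eq {s : Set (Pt n)} (hs : Bornology.IsBounded s) {L : ℝ} (hL0 : 0 ≤ L)
    (hL : ∀ p ∈ s, ∀ q ∈ s, |F p - F q| ≤ L * dist p q) :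
    ∃ M L' : ℝ, 0 ≤ M ∧ 0 ≤ L' ∧ lipNorm s F = M + L' ∧ (∀ p ∈ s, |F p| ≤ M) ∧
      ∀ p ∈ s, ∀ q ∈ s, |F p - F q| ≤ L' * dist p q := by
  refine ⟨⨆ x : s, |F x|, ⨆ p : s × s, |F p.1 - F p.2| / dist (p.1 : Pt n) (p.2 : Pt n),
    Real.iSup_nonneg fun _ => abs_nonneg _, Real.iSup_nonneg fun _ => by positivity, rfl,
    fun p hp => ?_, fun p hp q hq => ?_⟩
  · obtain ⟨D, hD⟩ := Metric.isBounded_iff.1 hs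
    refine le_ciSup (f := fun x : s => |F x|) ⟨L * D + |F p|, ?_⟩ ⟨p, hp⟩
    rintro _ ⟨q, rfl⟩
    have h1 : L * dist (q : Pt n) p ≤ L * D := by gcongr; exact hD q.2 hp
    have h2 := hL q q.2 p hp
    have h3 := abs_sub_abs_le_abs_sub (F q) (F p)
    change |F q| ≤ _
    linarith
  · rcases eq_or_ne p q with rfl | hpq
    · simp
    · rw [← div_le_iff₀ (dist_pos.2 hpq)]
      refine le_ciSup (f := fun p : s × s => |F p.1 - F p.2| / dist (p.1 : Pt n) (p.2 : Pt n))
        ⟨L, ?_⟩ (⟨p, hp⟩, ⟨q, hq⟩)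
      rintro _ ⟨r, rfl⟩
      exact div_le_of_le_mul₀ dist_nonneg hL0 (hL _ r.1.2 _ r.2.2)

end LipNorm

/-! ### Choice of constants and the boundary estimate -/

/-- The amplitude is chosen so that 2μA = (6/δ)e^{M₀(R/δ)²}, which offsets the smallest value of
e^{−μ|p−w|²} on the ball of radius R. -/
lemma slope_bounds {w p : Pt n} {δ R M₀ : ℝ} (hδ : 0 < δ) (hM₀ : 0 < M₀) (hp : ‖p - w‖ ≤ R) :
    6 / δ ≤ slope w (M₀ / δ ^ 2) (3 * δ * Real.exp (M₀ * (R / δ) ^ 2) / M₀) p := by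
  have h1 : M₀ / δ ^ 2 * ‖p - w‖ ^ 2 ≤ M₀ * (R / δ) ^ 2 := by
    calc M₀ / δ ^ 2 * ‖p - w‖ ^ 2 ≤ M₀ / δ ^ 2 * R ^ 2 := by gcongr
      _ = _ := by ring
  have h2 : slope w (M₀ / δ ^ 2) (3 * δ * Real.exp (M₀ * (R / δ) ^ 2) / M₀) p =
      6 / δ * Real.exp (M₀ * (R / δ) ^ 2 - M₀ / δ ^ 2 * ‖p - w‖ ^ 2) := by
    rw [slope, Real.exp_sub, Real.exp_neg]
    field_simp
    norm_num
  rw [h2]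
  exact le_mul_of_one_le_right (by positivity) (Real.one_le_exp (by linarith))

/-- Boundary estimate for small step size, with explicit constants. -/
lemma abs_value_sub_le_of_small {Ω : Set (Pt n)} {F : Pt n → ℝ} {α γ ε δ R c M₀ M L : ℝ}
    (hΩ : IsOpen Ω) (hb : Bornology.IsBounded Ω) (hα0 : 0 ≤ α) (hα1 : α ≤ 1) (hγ : 0 ≤ γ)
    (hδ : 0 < δ) (hε : 0 < ε) (hd0 : 0 ≤ 1 - γ * ε ^ 2)
    (hc0 : 0 < c) (hc : ∀ v : Pt n, c * ‖v‖ ^ 2 ≤ ∫ s, inner ℝ v s ^ 2 ∂uniformBall n)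
    (hM48 : 48 ≤ M₀) (hMc : 2 ≤ M₀ * c) (hεδ : ε ≤ δ) (hεR : ε ≤ R)
    {μ A : ℝ} (hμ : μ = M₀ / δ ^ 2) (hA : A = 3 * δ * Real.exp (M₀ * (R / δ) ^ 2) / M₀)
    (hsmall : 3 * μ * ε * R ≤ 1)
    (herr : (2 * μ * A) * (μ * R + 14 * μ ^ 2 * R ^ 3) * ε ≤ 1 / δ)
    (hM0 : 0 ≤ M) (hL0 : 0 ≤ L) (hpos : 0 < M + L) (hM : ∀ p ∈ outerStrip Ω ε, |F p| ≤ M)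
    (hL : ∀ p ∈ outerStrip Ω ε, ∀ q ∈ outerStrip Ω ε, |F p - F q| ≤ L * dist p q)
    {w x y z : Pt n} (hball : ∀ p ∈ Ω, δ ≤ ‖p - w‖) (hR : ∀ p ∈ Ω, ‖p - w‖ ≤ R)
    (hyw : ‖y - w‖ = δ) (hx : x ∈ Ω) (hz : z ∈ outerStrip Ω ε) (hzy : dist z y ≤ δ) :
    ∀ u ∈ ({valueI Ω F α γ ε, valueII Ω F α γ ε} : Set (Pt n → ℝ)),
      |u x - F z| ≤ (1 + γ) * (2 + R / δ + 6 * (R / δ + 1) * Real.exp (M₀ * (R / δ) ^ 2)) * (M + L)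
        * (dist x y + ε) + (M + L) * δ := by
  have hM₀ : 0 < M₀ := by linarith
  have hRpos : 0 < R := hε.trans_le hεR
  have hμ0 : 0 < μ := by rw [hμ]; positivity
  have hA0 : 0 < A := by rw [hA]; positivity
  set e := Real.exp (M₀ * (R / δ) ^ 2) with he
  have he0 : 0 < e := Real.exp_pos _
  -- `N` dominates M(1+γ), as discounting requires, and is at least L; so `lam` = L/N is at most 1,
  -- as the drift estimates require, and N·lam = L.
  set N := (1 + γ) * (M + L) with hN
  have hN0 : 0 < N := by positivity
  set lam := L / N with hlam
  have hNlam : N * lam = L := mul_div_cancel₀ L hN0.ne'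
  have hlam0 : 0 ≤ lam := by positivity
  have hγML : 0 ≤ γ * (M + L) := by positivity
  have hlam1 : lam ≤ 1 := by
    rw [hlam, div_le_one hN0]; linarith
  have hMN : M * (1 + γ) ≤ N := by
    have : 0 ≤ γ * L := by positivity
    linarith
  have hd1 : 1 - γ * ε ^ 2 ≤ 1 := by
    have : 0 ≤ γ * ε ^ 2 := by positivity
    linarith
  have hF : ContinuousOn F (outerStrip Ω ε) := by
    refine LipschitzOnWith.continuousOn (K := ⟨L, hL0⟩) (LipschitzOnWith.of_dist_le_mul ?_)
    intro p hp q hq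
    rw [Real.dist_eq]
    exact hL p hp q hq
  have hzw : ‖z - w‖ ≤ 2 * δ := by
    have := norm_sub_le_norm_sub_add_norm_sub z y w
    rw [dist_eq_norm] at hzy
    linarith
  have hμδ : μ * δ ^ 2 = M₀ := by rw [hμ]; field_simp
  have hAμ : A * μ = 3 * e / δ := by rw [hA, hμ]; field_simp
  have hslope : ∀ p ∈ Ω, 6 / δ ≤ slope w μ A p := fun p hp => by
    rw [hμ, hA]; exact slope_bounds hδ hM₀ (hR p hp)
  -- either player may pull
  have hpull : ∀ p ∈ Ω, ∀ s : Pt n, ‖s‖ ≤ 1 →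
      α / 2 * (barrier w z δ μ A lam (p + ε • pullDir w z δ μ A lam ε p)
          + barrier w z δ μ A lam (p + ε • s))
        + (1 - α) * ∫ v, barrier w z δ μ A lam (p + ε • v) ∂uniformBall n
        ≤ barrier w z δ μ A lam p - ε ^ 2 / δ := by
    intro p hp s hs
    have h1 := barrier_pull_add_le w z hδ hμ0 hA0.le hlam0 hlam1 hε hεδ hεR hsmall herr
      (hM48.trans_eq hμδ.symm) (hball p hp) (hR p hp) (hslope p hp) hzw hs
    have h2 := barrier_integral_le w z hδ hμ0 hA0.le hlam0 hlam1 hε hεR hsmall herr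
      (by rwa [hμδ]) hc hc0 (hball p hp) (hR p hp) (hslope p hp)
    have h3 := mul_le_mul_of_nonneg_left h1 (by positivity : 0 ≤ α / 2)
    have h4 := mul_le_mul_of_nonneg_left h2 (by linarith : 0 ≤ 1 - α)
    linarith
  have hL' : ∀ p ∈ outerStrip Ω ε, |F p - F z| ≤ N * lam * ‖p - z‖ := fun p hp => by
    rw [hNlam, ← dist_eq_norm]; exact hL p hp z hz
  set S := pullStrategy w z μ A lam hδ hε with hS
  have hmem1 : ∀ (T : Strategy n) k h, ‖T.move k h‖ ≤ 1 := fun T k h =>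
    (mem_ball_zero_iff.1 (T.move_mem k h)).le
  have hI : ∀ SII, |expectedPayoff Ω F α γ ε S SII x - F z| ≤
      N * barrier w z δ μ A lam x + M * δ + N * (A * (μ * (2 * δ * ε))) := fun SII =>
    abs_expectedPayoff_sub_le hΩ hb hδ hμ0.le hA0.le hlam0 hε hα0 hα1 hγ hd0 hM0 hMN hF hM hL'
      hball hx hz fun k h hp => hpull _ hp _ (hmem1 SII k _)
  have hII : ∀ SI, |expectedPayoff Ω F α γ ε SI S x - F z| ≤
      N * barrier w z δ μ A lam x + M * δ + N * (A * (μ * (2 * δ * ε))) := fun SI =>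
    abs_expectedPayoff_sub_le hΩ hb hδ hμ0.le hA0.le hlam0 hε hα0 hα1 hγ hd0 hM0 hMN hF hM hL'
      hball hx hz fun k h hp => by
        rw [add_comm (barrier _ _ _ _ _ _ (_ + ε • SI.move _ _))]
        exact hpull _ hp _ (hmem1 SI k _)
  have hval := abs_value_sub_le (fun SI SII => abs_expectedPayoff_le hd0 hd1 hM0 hM SI SII x) hI hII
  -- Lδ comes from the barrier at x and Mδ from discounting; the overshoot 6eNε and the multiples of
  -- |x−y| go into the constant.
  have hbound : N * barrier w z δ μ A lam x + M * δ + N * (A * (μ * (2 * δ * ε))) ≤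
      (1 + γ) * (2 + R / δ + 6 * (R / δ + 1) * e) * (M + L) * (dist x y + ε) + (M + L) * δ := by
    have hdxy : dist x y = ‖x - y‖ := dist_eq_norm x y
    have h1 := norm_sub_le_norm_sub_add_norm_sub x y w
    have h2 := norm_sub_le_norm_sub_add_norm_sub x w y
    have h3 := norm_sub_le_norm_sub_add_norm_sub x y z
    rw [norm_sub_rev w y] at h2
    rw [dist_comm, dist_eq_norm] at hzy
    have hd : 0 ≤ ‖x - y‖ := norm_nonneg _
    have h4 := barrier_le (z := z) (lam := lam) (A := A) (μ := μ) (R := R) (d := ‖x - y‖) hδ hμ0.le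
      hA0.le hlam0 (hball x hx) (hR x hx) (by linarith) (by linarith) hd (by linarith [hR x hx])
    have h5 := mul_le_mul_of_nonneg_left h4 hN0.le
    have h6 : N * (lam * (δ + (1 + (R / δ + 1) / 2) * ‖x - y‖) + A * (μ * (2 * R * ‖x - y‖))) =
        L * δ + L * ((1 + (R / δ + 1) / 2) * ‖x - y‖) + N * (6 * e * (R / δ) * ‖x - y‖) := by
      have : A * (μ * (2 * R * ‖x - y‖)) = 6 * e * (R / δ) * ‖x - y‖ := by
        rw [← mul_assoc, hAμ]; ring
      rw [this, ← hNlam]; ring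
    have h7 : A * (μ * (2 * δ * ε)) = 6 * e * ε := by
      rw [← mul_assoc, hAμ]; field_simp; norm_num
    have hK : 1 ≤ R / δ := by
      rw [one_le_div hδ]; exact (hball x hx).trans (hR x hx)
    have hLN : L ≤ N := by linarith
    have h8 : L * ((1 + (R / δ + 1) / 2) * ‖x - y‖) ≤ N * ((2 + R / δ) * ‖x - y‖) := by
      have : 1 + (R / δ + 1) / 2 ≤ 2 + R / δ := by linarith
      gcongr
    have h9 : 0 ≤ N * (6 * e * ‖x - y‖) := by positivity
    have h10 : 0 ≤ N * ((2 + R / δ + 6 * (R / δ) * e) * ε) := by positivity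
    rw [h7, hdxy]
    rw [h6] at h5
    have h11 : (1 + γ) * (2 + R / δ + 6 * (R / δ + 1) * e) * (M + L) * (‖x - y‖ + ε) =
        N * ((2 + R / δ) * ‖x - y‖) + N * (6 * e * (R / δ) * ‖x - y‖) + N * (6 * e * ‖x - y‖)
          + N * ((2 + R / δ + 6 * (R / δ) * e) * ε) + N * (6 * e * ε) := by
      rw [hN]; ring
    rw [h11]
    linarith
  rintro u (rfl | rfl)
  · exact hval.1.trans hbound
  · exact hval.2.trans hbound

end TugOfWar

end

theorem mainTheorem5 (n : ℕ) (hn : 1 ≤ n) :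
    ∃ C : ℝ → ℝ → ℝ, (∀ K γ, 0 < C K γ) ∧
      ∀ (α γ R δ : ℝ), 0 < α → α < 1 → 0 ≤ γ → 0 < δ →
        ∃ ρ : ℝ → ℝ, Tendsto ρ (𝓝[>] 0) (𝓝 0) ∧
          ∀ (Ω : Set (TugOfWar.Pt n)), IsOpen Ω → IsConnected Ω → Bornology.IsBounded Ω →
            TugOfWar.ExteriorSphereCondition Ω →
          ∀ (ε : ℝ), 0 < ε → γ * ε ^ 2 < 1 / 2 →
          ∀ (F : TugOfWar.Pt n → ℝ),
            (∃ L : ℝ, 0 < L ∧ ∀ p ∈ TugOfWar.outerStrip Ω ε, ∀ q ∈ TugOfWar.outerStrip Ω ε,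
              |F p - F q| ≤ L * dist p q) →
          ∀ y ∈ frontier Ω, ∀ w : TugOfWar.Pt n,
            TugOfWar.IsExteriorBall Ω y w δ → Ω ⊆ Metric.ball w R →
          ∀ x ∈ Ω, ∀ z ∈ TugOfWar.outerStrip Ω ε, dist z y ≤ δ →
            ∀ u ∈ ({TugOfWar.valueI Ω F α γ ε, TugOfWar.valueII Ω F α γ ε} :
                Set (TugOfWar.Pt n → ℝ)),
              u z = F z ∧
              |u x - F z| ≤
                C (R / δ) γ * TugOfWar.lipNorm (TugOfWar.outerStrip Ω ε) F * (dist x y + ρ ε)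
                  + TugOfWar.lipNorm (TugOfWar.outerStrip Ω ε) F * δ := by
  obtain ⟨c, hc0, hc⟩ := TugOfWar.exists_le_integral_inner_sq_uniformBall n
  -- 48 serves the pulled move and 2/c the random move; c, and so `M₀`, depends only on n.
  set M₀ : ℝ := max 48 (2 / c) with hM₀
  have hM48 : 48 ≤ M₀ := le_max_left _ _
  have hMc : 2 ≤ M₀ * c := (div_le_iff₀ hc0).1 (le_max_right _ _)
  -- The absolute values keep the constant positive for all arguments; they disappear since R/δ and
  -- γ are nonnegative here.
  refine ⟨fun K γ => (1 + |γ|) * (2 + |K| + 6 * (|K| + 1) * Real.exp (M₀ * K ^ 2)),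
    fun K γ => by positivity, fun α γ R δ hα0 hα1 hγ hδ => ?_⟩
  set μ : ℝ := M₀ / δ ^ 2 with hμ
  set A : ℝ := 3 * δ * Real.exp (M₀ * (R / δ) ^ 2) / M₀ with hA
  set E : ℝ := (2 * μ * A) * (μ * R + 14 * μ ^ 2 * R ^ 3) with hE
  set good : ℝ → Prop := fun ε => ε ≤ δ ∧ 3 * μ * ε * R ≤ 1 ∧ E * ε ≤ 1 / δ with hgood
  have hev : ∀ᶠ ε in 𝓝[>] (0 : ℝ), good ε := by
    refine nhdsWithin_le_nhds ?_
    have h1 : ∀ᶠ ε in 𝓝 (0 : ℝ), ε ≤ δ := eventually_le_nhds hδ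
    have h2 : ∀ᶠ ε in 𝓝 (0 : ℝ), 3 * μ * ε * R ≤ 1 :=
      (Continuous.tendsto' (by fun_prop) 0 0 (by simp) :
        Tendsto (fun ε : ℝ => 3 * μ * ε * R) (𝓝 0) (𝓝 0)).eventually (eventually_le_nhds one_pos)
    have h3 : ∀ᶠ ε in 𝓝 (0 : ℝ), E * ε ≤ 1 / δ :=
      (Continuous.tendsto' (by fun_prop) 0 0 (by simp) :
        Tendsto (fun ε : ℝ => E * ε) (𝓝 0) (𝓝 0)).eventually
          (eventually_le_nhds (by positivity))
    filter_upwards [h1, h2, h3] with ε e1 e2 e3 using ⟨e1, e2, e3⟩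
  classical
  -- For ε too large for the barrier, the value 2 makes the estimate follow from |u(x) − F(z)| ≤ 2M,
  -- as C ≥ 1. Small ε are all good, so the limit is 0.
  refine ⟨fun ε => if good ε then ε else 2, ?_, ?_⟩
  · refine (tendsto_nhdsWithin_of_tendsto_nhds tendsto_id).congr' ?_
    filter_upwards [hev] with ε hε
    rw [if_pos hε, id]
  intro Ω hΩ _ hb _ ε hε hγε F ⟨L₀, hL₀, hLip⟩ y hy w hw hΩR x hx z hz hzy u hu
  have hd0 : 0 ≤ 1 - γ * ε ^ 2 := by linarith
  have hd1 : 1 - γ * ε ^ 2 ≤ 1 := by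
    have : 0 ≤ γ * ε ^ 2 := by positivity
    linarith
  have hball : ∀ p ∈ Ω, δ ≤ ‖p - w‖ := fun p hp => by
    by_contra! h
    exact hw.2.1 (mem_ball_iff_norm.2 h) hp
  have hR : ∀ p ∈ Ω, ‖p - w‖ ≤ R := fun p hp => (mem_ball_iff_norm.1 (hΩR hp)).le
  have hδR : δ ≤ R := (hball x hx).trans (hR x hx)
  obtain ⟨M, L, hM0, hL0, hnorm, hM, hL⟩ := TugOfWar.exists_lipNorm_eq
    (TugOfWar.isBounded_outerStrip (ε := ε) hb ⟨y, hy⟩) hL₀.le hLip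
  have hK : 0 ≤ R / δ := div_nonneg (hδ.le.trans hδR) hδ.le
  refine ⟨?_, ?_⟩
  · rcases hu with rfl | rfl
    · exact TugOfWar.valueI_of_mem_outerStrip hz
    · exact TugOfWar.valueII_of_mem_outerStrip hz
  rw [hnorm]
  simp only [abs_of_nonneg hγ, abs_of_nonneg hK]
  by_cases hcase : good ε ∧ 0 < M + L
  · obtain ⟨hg, hpos⟩ := hcase
    rw [if_pos hg]
    exact TugOfWar.abs_value_sub_le_of_small hΩ hb hα0.le hα1.le hγ hδ hε hd0 hc0 hc hM48 hMc hg.1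
      (hg.1.trans hδR) hμ hA hg.2.1 hg.2.2 hM0 hL0 hpos hM hL hball hR
      (mem_sphere_iff_norm.1 hw.2.2) hx hz hzy u hu
  · have habs : |u x - F z| ≤ 2 * M := by
      have hE : ∀ SI SII, |TugOfWar.expectedPayoff Ω F α γ ε SI SII x - F z| ≤ 2 * M :=
        fun SI SII => (abs_sub _ _).trans (by
          linarith [TugOfWar.abs_expectedPayoff_le (α := α) hd0 hd1 hM0 hM SI SII x, hM z hz])
      obtain ⟨S⟩ : Nonempty (TugOfWar.Strategy n) := inferInstance
      have hval := TugOfWar.abs_value_sub_le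
        (fun SI SII => TugOfWar.abs_expectedPayoff_le hd0 hd1 hM0 hM SI SII x) (hE S) (hE · S)
      rcases hu with rfl | rfl
      exacts [hval.1, hval.2]
    have hδ' : 0 ≤ (M + L) * δ := by positivity
    set C := (1 + γ) * (2 + R / δ + 6 * (R / δ + 1) * Real.exp (M₀ * (R / δ) ^ 2)) with hC
    have hexp : 0 ≤ 6 * (R / δ + 1) * Real.exp (M₀ * (R / δ) ^ 2) := by positivity
    have hC1 : 1 ≤ C := one_le_mul_of_one_le_of_one_le (by linarith) (by linarith)
    by_cases hpos : 0 < M + L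
    · rw [if_neg fun hg => hcase ⟨hg, hpos⟩]
      have h1 : 1 * (M + L) * (0 + 2) ≤ C * (M + L) * (dist x y + 2) := by
        gcongr
        exact dist_nonneg
      linarith
    · have hzero : M + L = 0 := le_antisymm (not_lt.1 hpos) (by positivity)
      rw [hzero]
      linarith
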